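/- For $\alpha\in\mathbb{R}$, $1\le q\le 2$ and $u\in H_0^1(-1,1)$, $u\not\equiv 0$, put $$\mathcal Q[u,\alpha]=\frac{\int_{-1}^{1}|u'|^{2}\,dx+\alpha\left|\int_{-1}^{1}|u|^{q-1}u\,dx\right|^{2/q}}{\int_{-1}^{1}|u|^{2}\,dx},\qquad \lambda(\alpha,q)=\inf\left\{\mathcal Q[u,\alpha]:\ u\in H_0^1(-1,1),\ u\not\equiv0\right\},$$ where elements of $H_0^1(-1,1)$ are identified with their continuous representatives on $[-1,1]$. A minimizer of $\lambda(\alpha,q)$ is a function $y\in H_0^1(-1,1)$, $y\not\equiv0$, with $\mathcal Q[y,\alpha]=\lambda(\alpha,q)$. Let $$\alpha_q=\min\{\alpha\in\mathbb{R}:\ \lambda(\alpha,q)=\pi^2\}.$$ For every $1\le q\le 2$ this critical value is well defined: $\alpha_q>0$, $\lambda(\alpha,q)<\pi^2$ for $\alpha<\alpha_q$, and $\lambda(\alpha,q)=\pi^2$ for $\alpha\ge\alpha_q$. The following facts hold. 1. If $q=1$, then $\alpha_1=\frac{\pi^2}{2}$. Moreover, if $\alpha=\alpha_1$, there is a minimizer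 of $\lambda(\alpha_1,1)$ that is positive in $(-1,1)$, and for every $\bar x\in(-1,1)$ there is a minimizer $y$ of $\lambda(\alpha_1,1)$ which changes sign at $\bar x$ (namely $y>0$ in $(-1,\bar x)$, $y(\bar x)=0$ and $y<0$ in $(\bar x,1)$); when $\bar x\neq0$, this $y$ is non-symmetric (neither even nor odd) and $\int_{-1}^1 y\,dx\neq0$. 2. If $1<q\le2$ and $\alpha=\alpha_q$, then $\lambda(\alpha_q,q)$ admits both a minimizer that is positive in $(-1,1)$ and the minimizer $\sin\pi x$. Any minimizer of $\lambda(\alpha_q,q)$ either has constant sign in $(-1,1)$ (it is everywhere positive or everywhere negative there), or is equal to $C\sin\pi x$ on $[-1,1]$ for some constant $C\ne0$, and hence is odd. 3. If $q=2$, then $\alpha_2=\frac34\pi^2$. -/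

import Mathlib

open Set MeasureTheory

noncomputable section

namespace NonlocalEigenvalue

/-- The Sobolev space `H₀¹(-1,1)`, each class being represented by its continuous representative:
the functions that are absolutely continuous on `[-1,1]`, vanish at both end points and whose
(almost everywhere defined, equivalently weak) derivative is square integrable on `(-1,1)`.
Values outside `[-1,1]` are irrelevant. -/
structure MemH01 (u : ℝ → ℝ) : Prop where
  absolutelyContinuous : AbsolutelyContinuousOnInterval u (-1) 1
  left_eq_zero : u (-1) = 0
  right_eq_zero : u 1 = 0
  deriv_memLp : MemLp (deriv u) 2 (volume.restrict (Ioo (-1) 1))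

/-- The competitors of the minimum problem: nonzero elements of `H₀¹(-1,1)`. -/
def admissible : Set (ℝ → ℝ) :=
  {u | MemH01 u ∧ ∃ x ∈ Icc (-1 : ℝ) 1, u x ≠ 0}

/-- The nonlocal quotient
`(∫ |u'|² + α |∫ |u|^(q-1) u|^(2/q)) / ∫ |u|²`, all integrals being over `(-1,1)`. -/
def quotient (α q : ℝ) (u : ℝ → ℝ) : ℝ :=
  ((∫ x in (-1 : ℝ)..1, |deriv u x| ^ 2) +
      α * |∫ x in (-1 : ℝ)..1, |u x| ^ (q - 1) * u x| ^ (2 / q)) /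
    ∫ x in (-1 : ℝ)..1, |u x| ^ 2

/-- `λ(α,q)`, the infimum of the quotient over `H₀¹(-1,1) \ {0}`. -/
def eigenvalue (α q : ℝ) : ℝ :=
  sInf (quotient α q '' admissible)

/-- `y` is a minimizer of `λ(α,q)`. -/
def IsMinimizer (α q : ℝ) (y : ℝ → ℝ) : Prop :=
  y ∈ admissible ∧ IsMinOn (quotient α q) admissible y

/-- The critical value `α_q`, the smallest `α` with `λ(α,q) = π²`. -/
def criticalAlpha (q : ℝ) : ℝ :=
  sInf {α : ℝ | eigenvalue α q = Real.pi ^ 2}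

end NonlocalEigenvalue

end

/-!
Write `f s = |s| ^ (q - 1) * s` and `excess α q u = ∫ u'² + α |∫ f u| ^ (2/q) - π² ∫ u²`. All
assertions follow from the sharp inequality `0 ≤ excess α₀ q u` together with its cases of
equality: the value `α₀` for which it holds with a positive extremal is the critical value
(`criticalAlpha_eq`), and the minimizers at `α₀` are exactly the admissible functions of excess zero
(`isMinimizer_iff`).

*Lower bound.* The nonlocal term is linearised by Young's inequality (`mul_sub_mul_rpow_le`), which
replaces it by `k ∫ f u` for a multiplier `k`. The remaining functional is the Lagrangian action of
a particle in the potential `W s = π² s² - k f s`, on a time interval of length `2`. For every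
energy `E ≥ W` it is bounded below without solving an Euler–Lagrange equation: by
`u'² + (E - W u) ≥ 2 |u'| √(E - W u)`, a function of range `[-m, M]` has action at least
`4 ∫_{-m}^M √(E - W) - 2 E`, and equality forces `u' = ± √(E - W u)` between its extrema
(`MemH01.calibration_potential`, `MemH01.lower_bound`).

*Case `q = 1`.* The motions are harmonic and the area `∫ √(E - W)` is that of a half-disc, so the
bound gives `excess_one_nonneg`. The whole family `sin (π c / 2) + sin (π c / 2 - π x)`, with `c` in
`(-1, 1]`, has excess zero.

*Case `1 < q ≤ 2`.* After scaling, `u` has maximum `1` and minimum `-m` with `0 ≤ m ≤ 1`. Inverting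
the time integral along `s = sin θ` produces a multiplier `k₀` for which the positive motion with
turning points `0` and `1` takes exactly the time `2`; it is the positive extremal, and the virial
identity computes `α₀` from it (`exists_criticalPair_of_integral_slowness`). For a function that
changes sign the multiplier is chosen so that `W (-m) ≤ W 1`. If this is possible with `k₀` itself,
the lower bound at energy `W 1` already suffices. Otherwise `W (-m) = W 1`, and the bound is
compared with the one for the positive motion belonging to the same `k`, a scaled copy of the
extremal of lower energy (the rest state if `q = 2`). The derivative in `E` of `2 ∫ √(E - W)` over
`W < E` is the half-period `∫ 1 / √(E - W)`, which exceeds `1`: pointwise in the amplitude ratio,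
the motion is slower than the harmonic one of `q = 1` (`period_integrand_lt`). Hence the action
strictly increases with the energy (`action_lt`), which yields `IsCriticalPair.excess_nonneg`. Only
`m = 0`, where the extremal is positive, and `m = 1`, where `k = 0` and the extremal is `± sin (π
x)`, leave room for equality.
-/

noncomputable section

namespace NonlocalEigenvalue

/-! ### Calibration of the Dirichlet integral -/

/-- The composition of a `C¹` function with an absolutely continuous one is absolutely
continuous. -/
theorem _root_.ContDiff.comp_absolutelyContinuousOnInterval {G u : ℝ → ℝ} {a b : ℝ}
    (hG : ContDiff ℝ 1 G) (hu : AbsolutelyContinuousOnInterval u a b) :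
    AbsolutelyContinuousOnInterval (fun x => G (u x)) a b := by
  obtain ⟨C, hC⟩ := hu.exists_bound
  obtain ⟨K, hK⟩ := (hG.contDiffOn (s := Icc (-C) C)).exists_lipschitzOnWith (by decide)
    (convex_Icc _ _) isCompact_Icc
  have hmem : ∀ x ∈ uIcc a b, u x ∈ Icc (-C) C := fun x hx => abs_le.mp (hC x hx)
  rw [absolutelyContinuousOnInterval_iff] at hu ⊢
  intro ε hε
  obtain ⟨δ, hδ, h⟩ := hu (ε / (K + 1)) (by positivity)
  refine ⟨δ, hδ, fun F hF hFδ => ?_⟩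
  have h1 := h F hF hFδ
  calc _ ≤ ∑ i ∈ Finset.range F.1, K * dist (u (F.2 i).1) (u (F.2 i).2) := by
        refine Finset.sum_le_sum fun i hi => ?_
        exact hK.dist_le_mul _ (hmem _ (hF.1 i hi).1) _ (hmem _ (hF.1 i hi).2)
    _ = K * ∑ i ∈ Finset.range F.1, dist (u (F.2 i).1) (u (F.2 i).2) := by
        rw [Finset.mul_sum]
    _ ≤ (K + 1) * ∑ i ∈ Finset.range F.1, dist (u (F.2 i).1) (u (F.2 i).2) := by
        gcongr
        linarith
    _ < (K + 1) * (ε / (K + 1)) := by gcongr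
    _ = ε := by field_simp

theorem integral_comp_mul_deriv_of_absolutelyContinuous {g u : ℝ → ℝ} {a b : ℝ}
    (hg : Continuous g) (hu : AbsolutelyContinuousOnInterval u a b) :
    ∫ x in a..b, g (u x) * deriv u x = ∫ s in (u a)..(u b), g s := by
  set G : ℝ → ℝ := fun s => ∫ t in (0 : ℝ)..s, g t
  have hGd : ∀ s, HasDerivAt G (g s) s := fun s =>
    intervalIntegral.integral_hasDerivAt_right (hg.intervalIntegrable _ _)
      hg.aestronglyMeasurable.stronglyMeasurableAtFilter hg.continuousAt
  have hG : ContDiff ℝ 1 G := by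
    rw [contDiff_one_iff_deriv]
    refine ⟨fun s => (hGd s).differentiableAt, ?_⟩
    rwa [show deriv G = g from funext fun s => (hGd s).deriv]
  have h := (hG.comp_absolutelyContinuousOnInterval hu).integral_deriv_eq_sub
  rw [intervalIntegral.integral_interval_sub_left (hg.intervalIntegrable _ _)
    (hg.intervalIntegrable _ _)] at h
  rw [← h]
  refine intervalIntegral.integral_congr_ae ?_
  filter_upwards [hu.ae_differentiableAt] with x hx hxm
  have := (hGd (u x)).comp x (hx (uIoc_subset_uIcc hxm)).hasDerivAt
  exact this.deriv.symm

namespace MemH01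

variable {u : ℝ → ℝ}

theorem continuousOn (hu : MemH01 u) : ContinuousOn u (Icc (-1) 1) := by
  have := hu.absolutelyContinuous.continuousOn
  rwa [uIcc_of_le (by norm_num)] at this

theorem absolutelyContinuous_sub (hu : MemH01 u) {a b : ℝ} (ha : a ∈ Icc (-1 : ℝ) 1)
    (hb : b ∈ Icc (-1 : ℝ) 1) : AbsolutelyContinuousOnInterval u a b :=
  hu.absolutelyContinuous.mono (by
    rw [uIcc_of_le (by norm_num : (-1 : ℝ) ≤ 1)]
    exact (uIcc_subset_Icc ha hb))

theorem intervalIntegrable_comp (hu : MemH01 u) {g : ℝ → ℝ} (hg : Continuous g) {a b : ℝ}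
    (ha : a ∈ Icc (-1 : ℝ) 1) (hb : b ∈ Icc (-1 : ℝ) 1) :
    IntervalIntegrable (fun x => g (u x)) volume a b :=
  (hg.comp_continuousOn (hu.continuousOn.mono (uIcc_subset_Icc ha hb))).intervalIntegrable

theorem intervalIntegrable_deriv_sq (hu : MemH01 u) {a b : ℝ}
    (ha : a ∈ Icc (-1 : ℝ) 1) (hb : b ∈ Icc (-1 : ℝ) 1) :
    IntervalIntegrable (fun x => deriv u x ^ 2) volume a b := by
  have h := hu.deriv_memLp.integrable_sq
  have h' : IntervalIntegrable (fun x => deriv u x ^ 2) volume (-1) 1 := by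
    rw [intervalIntegrable_iff_integrableOn_Ioo_of_le (by norm_num)]
    exact h
  refine h'.mono_set ?_
  rw [uIcc_of_le (by norm_num : (-1 : ℝ) ≤ 1)]
  exact uIcc_subset_Icc ha hb

/-- Completing the square against the field `σ g`, where `σ = ±1`. -/
theorem integral_deriv_sq_add (hu : MemH01 u) {g : ℝ → ℝ} (hg : Continuous g) {a b σ : ℝ}
    (hσ : σ ^ 2 = 1) (ha : a ∈ Icc (-1 : ℝ) 1) (hb : b ∈ Icc (-1 : ℝ) 1) :
    (∫ x in a..b, deriv u x ^ 2) + ∫ x in a..b, g (u x) ^ 2 =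
      2 * σ * (∫ s in (u a)..(u b), g s) + ∫ x in a..b, (deriv u x - σ * g (u x)) ^ 2 := by
  have hac := hu.absolutelyContinuous_sub ha hb
  rw [← integral_comp_mul_deriv_of_absolutelyContinuous hg hac]
  have i1 := hu.intervalIntegrable_deriv_sq ha hb
  have i2 := hu.intervalIntegrable_comp (g := fun s => g s ^ 2) (hg.pow 2) ha hb
  have i3 : IntervalIntegrable (fun x => g (u x) * deriv u x) volume a b :=
    hac.intervalIntegrable_deriv.continuousOn_mul (hg.comp_continuousOn hac.continuousOn)
  have e : ∀ x, (deriv u x - σ * g (u x)) ^ 2 =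
      deriv u x ^ 2 + g (u x) ^ 2 - 2 * σ * (g (u x) * deriv u x) := fun x => by
    linear_combination (g (u x)) ^ 2 * hσ
  simp_rw [e]
  rw [intervalIntegral.integral_sub (i1.add i2) (i3.const_mul _),
    intervalIntegral.integral_add i1 i2, intervalIntegral.integral_const_mul]
  ring

/-- If the square in `MemH01.integral_deriv_sq_add` integrates to zero, then `u` solves
`u' = σ g(u)` in integrated form. -/
theorem sub_eq_integral_of_integral_sq_eq_zero (hu : MemH01 u) {g : ℝ → ℝ} (hg : Continuous g)
    {a b σ : ℝ} (ha : -1 ≤ a) (hab : a ≤ b) (hb : b ≤ 1)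
    (h0 : ∫ x in a..b, (deriv u x - σ * g (u x)) ^ 2 = 0) {c d : ℝ} (hc : c ∈ Icc a b)
    (hd : d ∈ Icc a b) : u d - u c = σ * ∫ x in c..d, g (u x) := by
  have ha' : a ∈ Icc (-1 : ℝ) 1 := ⟨ha, hab.trans hb⟩
  have hb' : b ∈ Icc (-1 : ℝ) 1 := ⟨ha.trans hab, hb⟩
  have hac := hu.absolutelyContinuous_sub ha' hb'
  have i1 := hu.intervalIntegrable_deriv_sq ha' hb'
  have i2 := hu.intervalIntegrable_comp (g := fun s => g s ^ 2) (hg.pow 2) ha' hb'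
  have i3 : IntervalIntegrable (fun x => g (u x) * deriv u x) volume a b :=
    hac.intervalIntegrable_deriv.continuousOn_mul (hg.comp_continuousOn hac.continuousOn)
  have i4 : IntervalIntegrable (fun x => (deriv u x - σ * g (u x)) ^ 2) volume a b := by
    refine ((i1.add (i2.const_mul (σ ^ 2))).sub (i3.const_mul (2 * σ))).congr ?_
    intro x _
    simp only
    ring
  rw [intervalIntegral.integral_eq_zero_iff_of_le_of_nonneg_ae hab
    (Filter.Eventually.of_forall fun x => sq_nonneg _) i4] at h0
  rw [← (hu.absolutelyContinuous_sub ⟨ha.trans hc.1, hc.2.trans hb⟩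
    ⟨ha.trans hd.1, hd.2.trans hb⟩).integral_deriv_eq_sub,
    ← intervalIntegral.integral_const_mul]
  refine intervalIntegral.integral_congr_ae ?_
  rw [Filter.EventuallyEq, ae_restrict_iff' measurableSet_Ioc] at h0
  filter_upwards [h0] with x hx hxm
  have hxab : x ∈ Ioc a b := by
    rw [mem_uIoc] at hxm
    rcases hxm with h | h
    · exact ⟨hc.1.trans_lt h.1, h.2.trans hd.2⟩
    · exact ⟨hd.1.trans_lt h.1, h.2.trans hc.2⟩
  have := hx hxab
  simp only [Pi.zero_apply] at this
  linarith [pow_eq_zero_iff (two_ne_zero) |>.mp this]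

/-- The calibration identity: a function of `H₀¹(-1,1)` is cut at `a ≤ b` into three pieces, on
which it is compared with the fields `σ g`, `-σ g` and `σ g`. -/
theorem calibration (hu : MemH01 u) {g : ℝ → ℝ} (hg : Continuous g) {a b σ : ℝ}
    (hσ : σ ^ 2 = 1) (ha : a ∈ Icc (-1 : ℝ) 1) (hb : b ∈ Icc (-1 : ℝ) 1) :
    (∫ x in (-1 : ℝ)..1, deriv u x ^ 2) + ∫ x in (-1 : ℝ)..1, g (u x) ^ 2 =
      4 * σ * (∫ s in (u b)..(u a), g s) +
        ((∫ x in (-1 : ℝ)..a, (deriv u x - σ * g (u x)) ^ 2) +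
          (∫ x in a..b, (deriv u x - (-σ) * g (u x)) ^ 2) +
          ∫ x in b..1, (deriv u x - σ * g (u x)) ^ 2) := by
  have hl : (-1 : ℝ) ∈ Icc (-1 : ℝ) 1 := by norm_num
  have hr : (1 : ℝ) ∈ Icc (-1 : ℝ) 1 := by norm_num
  have e1 := hu.integral_deriv_sq_add hg hσ hl ha
  have e2 := hu.integral_deriv_sq_add hg (σ := -σ) (by rw [neg_sq, hσ]) ha hb
  have e3 := hu.integral_deriv_sq_add hg hσ hb hr
  have i1 := fun {a b : ℝ} (ha : a ∈ Icc (-1 : ℝ) 1) (hb : b ∈ Icc (-1 : ℝ) 1) =>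
    hu.intervalIntegrable_deriv_sq ha hb
  have i2 := fun {a b : ℝ} (ha : a ∈ Icc (-1 : ℝ) 1) (hb : b ∈ Icc (-1 : ℝ) 1) =>
    hu.intervalIntegrable_comp (g := fun s => g s ^ 2) (hg.pow 2) ha hb
  rw [hu.left_eq_zero] at e1
  rw [hu.right_eq_zero] at e3
  rw [← intervalIntegral.integral_add_adjacent_intervals (i1 hl ha) (i1 ha hr),
    ← intervalIntegral.integral_add_adjacent_intervals (i1 ha hb) (i1 hb hr),
    ← intervalIntegral.integral_add_adjacent_intervals (i2 hl ha) (i2 ha hr),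
    ← intervalIntegral.integral_add_adjacent_intervals (i2 ha hb) (i2 hb hr)]
  have j1 : (∫ s in (0 : ℝ)..(u a), g s) + (∫ s in (u a)..(u b), g s) +
      ∫ s in (u b)..0, g s = 0 := by
    rw [intervalIntegral.integral_add_adjacent_intervals,
      intervalIntegral.integral_add_adjacent_intervals,
      intervalIntegral.integral_same] <;> exact hg.intervalIntegrable _ _
  have j2 := intervalIntegral.integral_symm (μ := volume) (f := g) (u a) (u b)
  linear_combination e1 + e2 + e3 + 2 * σ * j1 - 4 * σ * j2

end MemH01

/-! ### The energy functional and its lower bound by the calibration -/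

/-- The odd power `|s|^(q-1) s`. -/
def signedPow (q s : ℝ) : ℝ := |s| ^ (q - 1) * s

/-- The potential `π² s² - k |s|^(q-1) s`. -/
def potential (q k s : ℝ) : ℝ := Real.pi ^ 2 * s ^ 2 - k * signedPow q s

/-- The speed `√(E - W(s))` at height `s` of a motion of energy `E` in the potential `W`; it is
zero where `W > E`. -/
def speed (q k E s : ℝ) : ℝ := √(E - potential q k s)

/-- The functional `∫ |u'|² + α |∫ |u|^(q-1) u|^(2/q) - π² ∫ |u|²`, whose sign tells on which side
of `π²` the quotient of `u` lies. -/
def excess (α q : ℝ) (u : ℝ → ℝ) : ℝ :=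
  (∫ x in (-1 : ℝ)..1, |deriv u x| ^ 2) +
    α * |∫ x in (-1 : ℝ)..1, |u x| ^ (q - 1) * u x| ^ (2 / q) -
      Real.pi ^ 2 * ∫ x in (-1 : ℝ)..1, |u x| ^ 2

theorem continuous_signedPow {q : ℝ} (hq : 1 ≤ q) : Continuous (signedPow q) :=
  (continuous_abs.rpow_const fun _ => Or.inr (by linarith)).mul continuous_id

theorem continuous_potential {q : ℝ} (hq : 1 ≤ q) (k : ℝ) : Continuous (potential q k) :=
  (continuous_const.mul (continuous_pow 2)).sub (continuous_const.mul (continuous_signedPow hq))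

theorem continuous_speed {q : ℝ} (hq : 1 ≤ q) (k E : ℝ) : Continuous (speed q k E) :=
  (continuous_const.sub (continuous_potential hq k)).sqrt

theorem signedPow_neg (q s : ℝ) : signedPow q (-s) = -signedPow q s := by
  simp [signedPow]

theorem signedPow_of_nonneg {q s : ℝ} (hq : 1 ≤ q) (hs : 0 ≤ s) : signedPow q s = s ^ q := by
  rcases hs.eq_or_lt with rfl | hs
  · simp [signedPow, Real.zero_rpow (by linarith : q ≠ 0)]
  · rw [signedPow, abs_of_pos hs, Real.rpow_sub_one hs.ne']
    field_simp

theorem signedPow_one (s : ℝ) : signedPow 1 s = s := by simp [signedPow]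

theorem signedPow_zero (q : ℝ) : signedPow q 0 = 0 := by simp [signedPow]

theorem signedPow_mul (q c s : ℝ) : signedPow q (c * s) = signedPow q c * signedPow q s := by
  simp only [signedPow, abs_mul, Real.mul_rpow (abs_nonneg c) (abs_nonneg s)]
  ring

theorem abs_signedPow {q : ℝ} (hq : 1 ≤ q) (s : ℝ) : |signedPow q s| = |s| ^ q := by
  rw [← signedPow_of_nonneg hq (abs_nonneg s)]
  simp only [signedPow, abs_mul, abs_abs]
  rw [abs_of_nonneg (Real.rpow_nonneg (abs_nonneg s) _)]

theorem potential_zero (q k : ℝ) : potential q k 0 = 0 := by simp [potential, signedPow_zero]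

theorem potential_neg (q k s : ℝ) :
    potential q k (-s) = Real.pi ^ 2 * s ^ 2 + k * signedPow q s := by
  rw [potential, signedPow_neg]; ring

theorem potential_of_nonneg {q s : ℝ} (hq : 1 ≤ q) (k : ℝ) (hs : 0 ≤ s) :
    potential q k s = Real.pi ^ 2 * s ^ 2 - k * s ^ q := by
  rw [potential, signedPow_of_nonneg hq hs]

theorem speed_nonneg (q k E s : ℝ) : 0 ≤ speed q k E s := Real.sqrt_nonneg _

theorem speed_sq {q k E s : ℝ} (h : potential q k s ≤ E) :
    speed q k E s ^ 2 = E - potential q k s := Real.sq_sqrt (by linarith)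

theorem excess_eq (α q : ℝ) (u : ℝ → ℝ) :
    excess α q u = (∫ x in (-1 : ℝ)..1, deriv u x ^ 2) +
      α * |∫ x in (-1 : ℝ)..1, signedPow q (u x)| ^ (2 / q) -
        Real.pi ^ 2 * ∫ x in (-1 : ℝ)..1, u x ^ 2 := by
  simp only [excess, sq_abs, signedPow]

namespace MemH01

variable {u : ℝ → ℝ}

theorem const_mul (hu : MemH01 u) (c : ℝ) : MemH01 (fun x => c * u x) where
  absolutelyContinuous := hu.absolutelyContinuous.const_mul c
  left_eq_zero := by simp [hu.left_eq_zero]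
  right_eq_zero := by simp [hu.right_eq_zero]
  deriv_memLp := by
    have : deriv (fun x => c * u x) = fun x => c * deriv u x := by
      ext x; exact deriv_const_mul_field c
    rw [this]
    exact hu.deriv_memLp.const_mul c

/-- The calibration identity for the speed of a motion in the potential, as long as the range of
`u` is accessible with the energy `E`. -/
theorem calibration_potential (hu : MemH01 u) {q : ℝ} (hq : 1 ≤ q) {k E : ℝ}
    (hE : ∀ x ∈ Icc (-1 : ℝ) 1, potential q k (u x) ≤ E) {a b σ : ℝ}
    (hσ : σ ^ 2 = 1) (ha : a ∈ Icc (-1 : ℝ) 1) (hb : b ∈ Icc (-1 : ℝ) 1) :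
    (∫ x in (-1 : ℝ)..1, deriv u x ^ 2) - Real.pi ^ 2 * (∫ x in (-1 : ℝ)..1, u x ^ 2) +
        k * ∫ x in (-1 : ℝ)..1, signedPow q (u x) =
      4 * σ * (∫ s in (u b)..(u a), speed q k E s) - 2 * E +
        ((∫ x in (-1 : ℝ)..a, (deriv u x - σ * speed q k E (u x)) ^ 2) +
          (∫ x in a..b, (deriv u x - (-σ) * speed q k E (u x)) ^ 2) +
          ∫ x in b..1, (deriv u x - σ * speed q k E (u x)) ^ 2) := by
  have h := hu.calibration (continuous_speed hq k E) hσ ha hb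
  have hl : (-1 : ℝ) ∈ Icc (-1 : ℝ) 1 := by norm_num
  have hr : (1 : ℝ) ∈ Icc (-1 : ℝ) 1 := by norm_num
  have e : ∫ x in (-1 : ℝ)..1, speed q k E (u x) ^ 2 =
      ∫ x in (-1 : ℝ)..1, (E - Real.pi ^ 2 * u x ^ 2 + k * signedPow q (u x)) := by
    refine intervalIntegral.integral_congr fun x hx => ?_
    rw [uIcc_of_le (by norm_num)] at hx
    rw [speed_sq (hE x hx), potential]
    ring
  have i1 := hu.intervalIntegrable_comp (g := fun s => s ^ 2) (continuous_pow 2) hl hr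
  have i2 := hu.intervalIntegrable_comp (continuous_signedPow hq) hl hr
  rw [intervalIntegral.integral_add (intervalIntegrable_const.sub (i1.const_mul _))
    (i2.const_mul _), intervalIntegral.integral_sub intervalIntegrable_const (i1.const_mul _),
    intervalIntegral.integral_const_mul, intervalIntegral.integral_const_mul,
    intervalIntegral.integral_const] at e
  rw [e, show ((1 : ℝ) - -1) • E = 2 * E by norm_num] at h
  linear_combination h

/-- The lower bound given by the calibration, for a function whose extreme values are `M` and
`-m`. -/
theorem lower_bound (hu : MemH01 u) {q : ℝ} (hq : 1 ≤ q) {k E m M : ℝ}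
    (hE : ∀ x ∈ Icc (-1 : ℝ) 1, potential q k (u x) ≤ E)
    (hM : ∃ x ∈ Icc (-1 : ℝ) 1, u x = M) (hm : ∃ x ∈ Icc (-1 : ℝ) 1, u x = -m) :
    4 * (∫ s in (-m)..M, speed q k E s) - 2 * E ≤
      (∫ x in (-1 : ℝ)..1, deriv u x ^ 2) - Real.pi ^ 2 * (∫ x in (-1 : ℝ)..1, u x ^ 2) +
        k * ∫ x in (-1 : ℝ)..1, signedPow q (u x) := by
  obtain ⟨a, ha, rfl⟩ := hM
  obtain ⟨b, hb, hbm⟩ := hm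
  have key : ∀ {c d σ : ℝ}, c ≤ d → d ≤ 1 → -1 ≤ c →
      0 ≤ ((∫ x in (-1 : ℝ)..c, (deriv u x - σ * speed q k E (u x)) ^ 2) +
          (∫ x in c..d, (deriv u x - (-σ) * speed q k E (u x)) ^ 2) +
          ∫ x in d..1, (deriv u x - σ * speed q k E (u x)) ^ 2) := by
    intro c d σ hcd hd hc
    have h1 := intervalIntegral.integral_nonneg (μ := volume) hc
      (fun x _ => sq_nonneg (deriv u x - σ * speed q k E (u x)))
    have h2 := intervalIntegral.integral_nonneg (μ := volume) hcd
      (fun x _ => sq_nonneg (deriv u x - (-σ) * speed q k E (u x)))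
    have h3 := intervalIntegral.integral_nonneg (μ := volume) hd
      (fun x _ => sq_nonneg (deriv u x - σ * speed q k E (u x)))
    linarith
  rw [← hbm]
  rcases le_total a b with hab | hab
  · rw [hu.calibration_potential hq hE (σ := 1) (by norm_num) ha hb]
    have := key (σ := 1) hab hb.2 ha.1
    linarith
  · rw [hu.calibration_potential hq hE (σ := -1) (by norm_num) hb ha,
      intervalIntegral.integral_symm (u b)]
    have := key (σ := -1) hab ha.2 hb.1
    linarith

theorem integral_sq_pos (hu : MemH01 u) (h0 : ∃ x ∈ Icc (-1 : ℝ) 1, u x ≠ 0) :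
    0 < ∫ x in (-1 : ℝ)..1, u x ^ 2 := by
  obtain ⟨x, hx, hx0⟩ := h0
  exact intervalIntegral.integral_pos (by norm_num) (hu.continuousOn.pow 2)
    (fun x _ => sq_nonneg _) ⟨x, hx, by positivity⟩

end MemH01

theorem excess_const_mul (α : ℝ) {q : ℝ} (hq : 1 ≤ q) (c : ℝ) (u : ℝ → ℝ) :
    excess α q (fun x => c * u x) = c ^ 2 * excess α q u := by
  have hd : deriv (fun x => c * u x) = fun x => c * deriv u x := by
    ext x; exact deriv_const_mul_field c
  have hc : |signedPow q c| ^ (2 / q) = c ^ 2 := by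
    rw [abs_signedPow hq, ← Real.rpow_mul (abs_nonneg c), mul_div_cancel₀ _ (by linarith)]
    simp
  simp only [excess_eq, hd, signedPow_mul, mul_pow, intervalIntegral.integral_const_mul, abs_mul]
  rw [Real.mul_rpow (abs_nonneg _) (abs_nonneg _), hc]
  ring

theorem quotient_sub {u : ℝ → ℝ} (hu : u ∈ admissible) (α q : ℝ) :
    quotient α q u - Real.pi ^ 2 = excess α q u / ∫ x in (-1 : ℝ)..1, u x ^ 2 := by
  have h := hu.1.integral_sq_pos hu.2
  rw [excess, quotient]
  simp only [sq_abs]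
  field_simp

/-- Every nonzero element of `H₀¹(-1,1)` has a multiple with maximum `1` and minimum at least
`-1`. -/
theorem exists_normalised {u : ℝ → ℝ} (hu : u ∈ admissible) :
    ∃ c : ℝ, c ≠ 0 ∧ ∃ m ∈ Icc (0 : ℝ) 1, (∀ x ∈ Icc (-1 : ℝ) 1, c * u x ∈ Icc (-m) 1) ∧
      (∃ x ∈ Icc (-1 : ℝ) 1, c * u x = 1) ∧ ∃ x ∈ Icc (-1 : ℝ) 1, c * u x = -m := by
  obtain ⟨h, z, hz, hz0⟩ := hu
  have hne : (Icc (-1 : ℝ) 1).Nonempty := ⟨z, hz⟩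
  obtain ⟨p, hp, hpm⟩ := isCompact_Icc.exists_isMaxOn hne h.continuousOn.abs
  have hp0 : u p ≠ 0 := by
    have := hpm hz
    simp only [mem_ofPred_eq] at this
    exact abs_pos.mp ((abs_pos.mpr hz0).trans_le this)
  refine ⟨(u p)⁻¹, inv_ne_zero hp0, ?_⟩
  have hv : ContinuousOn (fun x => (u p)⁻¹ * u x) (Icc (-1) 1) :=
    continuousOn_const.mul h.continuousOn
  obtain ⟨b, hb, hbm⟩ := isCompact_Icc.exists_isMinOn hne hv
  have hbound : ∀ x ∈ Icc (-1 : ℝ) 1, |(u p)⁻¹ * u x| ≤ 1 := by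
    intro x hx
    have := hpm hx
    simp only [mem_ofPred_eq] at this
    rw [abs_mul, abs_inv, inv_mul_le_iff₀ (abs_pos.mpr hp0), mul_one]
    exact this
  refine ⟨-((u p)⁻¹ * u b), ⟨?_, ?_⟩, ?_, ⟨p, hp, inv_mul_cancel₀ hp0⟩, b, hb, by ring⟩
  · have := hbm (show (-1 : ℝ) ∈ Icc (-1 : ℝ) 1 by norm_num)
    simp only [mem_ofPred_eq, h.left_eq_zero, mul_zero] at this
    linarith
  · linarith [(abs_le.mp (hbound b hb)).1]
  · intro x hx
    have := hbm hx
    simp only [mem_ofPred_eq] at this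
    exact ⟨by linarith, (abs_le.mp (hbound x hx)).2⟩

/-! ### Comparison of the period with the case `q = 1` -/

theorem convexOn_sinh : ConvexOn ℝ (Ici 0) Real.sinh := by
  refine convexOn_of_deriv2_nonneg (convex_Ici 0) Real.continuous_sinh.continuousOn
    Real.differentiable_sinh.differentiableOn ?_ ?_
  · rw [Real.deriv_sinh]; exact Real.differentiable_cosh.differentiableOn
  · intro x hx
    rw [interior_Ici] at hx
    simp only [Function.iterate_succ, Function.iterate_zero, Function.comp_apply, id,
      Real.deriv_sinh, Real.deriv_cosh]
    exact Real.sinh_nonneg_iff.mpr hx.le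

/-- With `μ = exp (-2A)` this is `(1+θ) sinh((2-θ)A) ≤ sinh((2+θ)A) + θ sinh(θA)`, an instance of
the convexity of `sinh`. -/
theorem one_add_mul_rpow_sub_le {μ θ : ℝ} (hμ0 : 0 < μ) (hμ1 : μ < 1) (h0 : 0 ≤ θ) :
    (1 + θ) * (μ ^ θ - μ) * (1 + μ) ≤ (1 - μ) * (1 + μ * μ ^ θ) := by
  set A : ℝ := -Real.log μ / 2 with hA
  have hApos : 0 < A := by have := Real.log_neg hμ0 hμ1; rw [hA]; linarith
  have hμA : μ = Real.exp (-2 * A) := by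
    rw [hA, show -2 * (-Real.log μ / 2) = Real.log μ by ring, Real.exp_log hμ0]
  have hconv := convexOn_sinh.2
    (show (2 + θ) * A ∈ Ici (0 : ℝ) from mem_Ici.mpr (by positivity))
    (show θ * A ∈ Ici (0 : ℝ) from mem_Ici.mpr (by positivity))
    (show 0 ≤ 1 / (1 + θ) by positivity) (show 0 ≤ θ / (1 + θ) by positivity) (by field_simp)
  have hmono : Real.sinh ((2 - θ) * A) ≤
      Real.sinh ((1 / (1 + θ)) • ((2 + θ) * A) + (θ / (1 + θ)) • (θ * A)) := by
    rw [Real.sinh_le_sinh, smul_eq_mul, smul_eq_mul,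
      show 1 / (1 + θ) * ((2 + θ) * A) + θ / (1 + θ) * (θ * A) =
        ((2 + θ + θ * θ) / (1 + θ)) * A by field_simp]
    gcongr
    rw [le_div_iff₀ (by positivity)]
    nlinarith
  have h := hmono.trans hconv
  rw [smul_eq_mul, smul_eq_mul, show 1 / (1 + θ) * Real.sinh ((2 + θ) * A) +
    θ / (1 + θ) * Real.sinh (θ * A) = (Real.sinh ((2 + θ) * A) + θ * Real.sinh (θ * A)) / (1 + θ) by
      field_simp, le_div_iff₀ (by positivity)] at h
  have hθ : μ ^ θ = Real.exp (-2 * A * θ) := by rw [hμA, ← Real.exp_mul]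
  set e : ℝ := Real.exp (-(2 + θ) * A) with he
  have k1 : 2 * e * Real.sinh ((2 - θ) * A) = μ ^ θ - μ * μ := by
    rw [Real.sinh_eq, hθ, hμA, he]
    ring_nf
    simp only [← Real.exp_add, ← Real.exp_nat_mul]
    ring_nf
  have k2 : 2 * e * Real.sinh ((2 + θ) * A) = 1 - μ * μ * μ ^ θ := by
    rw [Real.sinh_eq, hθ, hμA, he]
    ring_nf
    simp only [← Real.exp_add, ← Real.exp_nat_mul]
    ring_nf
    simp
  have k3 : 2 * e * Real.sinh (θ * A) = μ - μ * μ ^ θ := by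
    rw [Real.sinh_eq, hθ, hμA, he]
    ring_nf
    simp only [← Real.exp_add]
    ring_nf
  have hm := mul_le_mul_of_nonneg_left h (show 0 ≤ 2 * e by positivity)
  have : (1 + θ) * (μ ^ θ - μ * μ) ≤ (1 - μ * μ * μ ^ θ) + θ * (μ - μ * μ ^ θ) := by
    rw [← k1, ← k2, ← k3]; linarith
  linarith

/-- For two intervals of the same length `δ`, the one further to the right sees the smaller
decrease of `t ↦ 1/√t`. -/
theorem inv_sqrt_sub_lt {a b δ : ℝ} (ha : 0 < a) (hab : a < b) (hδ : 0 < δ) :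
    1 / √b - 1 / √(b + δ) < 1 / √a - 1 / √(a + δ) := by
  have key : ∀ p : ℝ, 0 < p → 1 / √p - 1 / √(p + δ) = δ / (√p * √(p + δ) * (√p + √(p + δ))) := by
    intro p hp
    have h1 : 0 < √p := Real.sqrt_pos.mpr hp
    have h2 : 0 < √(p + δ) := Real.sqrt_pos.mpr (by linarith)
    have h3 : √p ^ 2 = p := Real.sq_sqrt hp.le
    have h4 : √(p + δ) ^ 2 = p + δ := Real.sq_sqrt (by linarith)
    field_simp
    linarith
  rw [key a ha, key b (ha.trans hab)]
  have h1 : 0 < √a := Real.sqrt_pos.mpr ha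
  have h2 : 0 < √(a + δ) := Real.sqrt_pos.mpr (by linarith)
  have h3 : √a < √b := Real.sqrt_lt_sqrt ha.le hab
  have h4 : √(a + δ) < √(b + δ) := Real.sqrt_lt_sqrt (by linarith) (by linarith)
  gcongr

/-- Pointwise comparison of the time of a full oscillation with that for `q = 1`, whose potential
is harmonic. Here `-μ` and `1` are the turning points and `z` is the resulting strength of the
nonlinear term. -/
theorem period_integrand_lt {q μ r : ℝ} (hq1 : 1 < q) (hq2 : q ≤ 2) (hμ0 : 0 < μ) (hμ1 : μ < 1)
    (hr0 : 0 < r) (hr1 : r < 1) {z : ℝ} (hz : z = (1 - μ ^ 2) / (1 + μ ^ q)) :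
    1 / √((1 - r) * (r + μ)) + 1 / √((1 - r) * (r + μ⁻¹)) <
      1 / √(1 - r ^ 2 - z * (1 - r ^ q)) + 1 / √(1 - r ^ 2 + z * μ ^ (q - 2) * (1 - r ^ q)) := by
  have hμq : 0 < μ ^ q := Real.rpow_pos_of_pos hμ0 q
  have hμq1 : μ ^ q < μ := by
    simpa using Real.rpow_lt_rpow_of_exponent_gt hμ0 hμ1 hq1
  have hrq : r ^ q < r := by
    simpa using Real.rpow_lt_rpow_of_exponent_gt hr0 hr1 hq1
  have hrq2 : r ^ 2 ≤ r ^ q := by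
    rw [← Real.rpow_natCast]
    exact Real.rpow_le_rpow_of_exponent_ge hr0 hr1.le (by simpa using hq2)
  have hz0 : 0 < z := by rw [hz]; apply div_pos <;> nlinarith
  have hz1 : z < 1 := by rw [hz, div_lt_one (by linarith)]; nlinarith
  have hzμ : 1 - μ < z := by
    rw [hz, lt_div_iff₀ (by linarith)]; nlinarith
  -- `X'` and `Y'` are the values of `X` and `Y` for `q = 1`. The claim follows from `X' < X`, which
  -- decreases the first radicand, and from `Y - X ≤ Y' - X'`, which bounds the growth of the
  -- second.
  set D := 1 - r ^ 2
  set X := z * (1 - r ^ q)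
  set X' := (1 - μ) * (1 - r)
  set Y := z * μ ^ (q - 2) * (1 - r ^ q)
  set Y' := (μ⁻¹ - 1) * (1 - r)
  have hX : X' < X := by
    simp only [X, X']
    nlinarith [mul_pos (sub_pos.mpr hzμ) (sub_pos.mpr hr1), mul_pos hz0 (sub_pos.mpr hrq)]
  have hXD : X < D := by
    simp only [X, D]
    nlinarith
  have hX' : 0 < X' := mul_pos (by linarith) (by linarith)
  have hinv : 1 < μ⁻¹ := (one_lt_inv₀ hμ0).mpr hμ1
  have hY' : 0 < Y' := mul_pos (by linarith) (by linarith)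
  have hYX : Y - X ≤ Y' - X' := by
    -- Bernoulli's inequality separates the variable `r` from `μ`.
    have hb : 1 - r ^ q ≤ q * (1 - r) := by
      have := one_add_mul_self_le_rpow_one_add (s := r - 1) (by linarith) hq1.le
      rw [show 1 + (r - 1) = r by ring] at this
      linarith
    have hm := one_add_mul_rpow_sub_le hμ0 hμ1 (θ := q - 1) (by linarith)
    set ρ := μ ^ (q - 1) with hρ
    have e1 : μ ^ q = μ * ρ := by
      rw [hρ, Real.rpow_sub_one hμ0.ne']; field_simp
    have e2 : μ ^ (q - 2) = ρ / μ := by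
      rw [hρ, ← Real.rpow_sub_one hμ0.ne']; congr 1; ring
    have hρ0 : 0 < ρ := Real.rpow_pos_of_pos hμ0 _
    have hρμ : μ ≤ ρ := by
      simpa using Real.rpow_le_rpow_of_exponent_ge hμ0 hμ1.le (show q - 1 ≤ 1 by linarith)
    have e3 : Y - X = (1 - r ^ q) * ((ρ - μ) * (1 - μ ^ 2) / (μ * (1 + μ * ρ))) := by
      simp only [X, Y]
      rw [hz, e1, e2]
      field_simp
    have e4 : Y' - X' = (1 - r) * ((1 - μ) ^ 2 / μ) := by
      simp only [X', Y']
      field_simp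
    rw [e3, e4]
    calc _ ≤ q * (1 - r) * ((ρ - μ) * (1 - μ ^ 2) / (μ * (1 + μ * ρ))) := by
          refine mul_le_mul_of_nonneg_right hb (div_nonneg (mul_nonneg (by linarith) ?_) ?_)
          · nlinarith
          · positivity
      _ = (1 - r) * (q * ((ρ - μ) * (1 - μ ^ 2) / (μ * (1 + μ * ρ)))) := by ring
      _ ≤ _ := by
          refine mul_le_mul_of_nonneg_left ?_ (by linarith)
          rw [← mul_div_assoc, div_le_div_iff₀ (by positivity) hμ0]
          have : 0 ≤ (1 - μ) * μ := by nlinarith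
          nlinarith [mul_le_mul_of_nonneg_left hm this]
  have e1 : (1 - r) * (r + μ) = D - X + (X - X') := by simp only [D, X, X']; ring
  have e2 : (1 - r) * (r + μ⁻¹) = D + Y' := by simp only [D, Y']; ring
  have hD : 0 < D := by simp only [D]; nlinarith
  have h1 := inv_sqrt_sub_lt (a := D - X) (b := D + Y') (δ := X - X') (by linarith) (by linarith)
    (by linarith)
  have hYpos : 0 < Y := by
    have : 0 < μ ^ (q - 2) := Real.rpow_pos_of_pos hμ0 _
    exact mul_pos (mul_pos hz0 this) (by linarith)
  have h2 : 1 / √(D + Y' + (X - X')) ≤ 1 / √(D + Y) := by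
    apply one_div_le_one_div_of_le (Real.sqrt_pos.mpr (by linarith))
    exact Real.sqrt_le_sqrt (by linarith)
  rw [e1, e2]
  linarith

/-! ### The action increases with the energy -/

theorem lintegral_Ioo_eq_ofReal_sub {F f : ℝ → ℝ} {a b : ℝ} (hab : a ≤ b)
    (hc : ContinuousOn F (Icc a b)) (hd : ∀ x ∈ Ioo a b, HasDerivAt F (f x) x)
    (hf : ∀ x ∈ Ioo a b, 0 ≤ f x) :
    ∫⁻ x in Ioo a b, ENNReal.ofReal (f x) = ENNReal.ofReal (F b - F a) := by
  have hint := intervalIntegral.integrableOn_deriv_of_nonneg hc hd hf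
  have h := intervalIntegral.integral_eq_sub_of_hasDerivAt_of_le hab hc hd
    ((intervalIntegrable_iff_integrableOn_Ioc_of_le hab).mpr hint)
  rw [intervalIntegral.integral_of_le hab, integral_Ioc_eq_integral_Ioo] at h
  rw [← h, ofReal_integral_eq_lintegral_ofReal (hint.mono_set Ioo_subset_Ioc_self)]
  exact (ae_restrict_iff' measurableSet_Ioo).mpr (Filter.Eventually.of_forall hf)

theorem lintegral_harmonic_half {c : ℝ} (hc : 0 < c) :
    ∫⁻ r in Ioo (0 : ℝ) 1, ENNReal.ofReal (1 / √((1 - r) * (r + c))) =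
      ENNReal.ofReal (Real.pi / 2 - Real.arcsin ((c - 1) / (1 + c))) := by
  have h := lintegral_Ioo_eq_ofReal_sub (F := fun r => Real.arcsin ((2 * r - 1 + c) / (1 + c)))
    (f := fun r => 1 / √((1 - r) * (r + c))) (zero_le_one' ℝ)
    (Real.continuous_arcsin.comp (by fun_prop)).continuousOn ?_ (fun r _ => by positivity)
  · rw [h]
    congr 2
    · rw [show (2 * (1 : ℝ) - 1 + c) / (1 + c) = 1 by field_simp; ring, Real.arcsin_one]
    · congr 2; ring
  · intro r hr
    have h1 : (0 : ℝ) < 1 - r := by linarith [hr.2]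
    have h2 : 0 < r + c := by linarith [hr.1]
    have hlt : (2 * r - 1 + c) / (1 + c) < 1 := by rw [div_lt_one (by linarith)]; linarith
    have hgt : -1 < (2 * r - 1 + c) / (1 + c) := by rw [lt_div_iff₀ (by linarith)]; linarith
    have hin : HasDerivAt (fun r : ℝ => (2 * r - 1 + c) / (1 + c)) (2 / (1 + c)) r := by
      have := ((((hasDerivAt_id r).const_mul 2).sub_const 1).add_const c).div_const (1 + c)
      simpa using this
    have := (Real.hasDerivAt_arcsin hgt.ne' hlt.ne).comp r hin
    have e : 1 - ((2 * r - 1 + c) / (1 + c)) ^ 2 = (2 / (1 + c)) ^ 2 * ((1 - r) * (r + c)) := by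
      field_simp; ring
    refine this.congr_deriv ?_
    rw [e, Real.sqrt_mul (by positivity), Real.sqrt_sq (by positivity)]
    field_simp

/-- The time of half an oscillation is `1` for `q = 1`, whatever the turning points. -/
theorem lintegral_harmonic {μ : ℝ} (hμ : 0 < μ) :
    ∫⁻ r in Ioo (0 : ℝ) 1, ENNReal.ofReal
      (Real.pi⁻¹ * (1 / √((1 - r) * (r + μ)) + 1 / √((1 - r) * (r + μ⁻¹)))) = 1 := by
  have hm : ∀ c : ℝ, Measurable fun r : ℝ => ENNReal.ofReal (1 / √((1 - r) * (r + c))) := by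
    intro c; fun_prop
  have hle : ∀ x : ℝ, Real.arcsin x ≤ Real.pi / 2 := Real.arcsin_le_pi_div_two
  calc _ = ∫⁻ r in Ioo (0 : ℝ) 1, ENNReal.ofReal Real.pi⁻¹ *
        (ENNReal.ofReal (1 / √((1 - r) * (r + μ))) +
          ENNReal.ofReal (1 / √((1 - r) * (r + μ⁻¹)))) := by
        refine lintegral_congr fun r => ?_
        rw [ENNReal.ofReal_mul (by positivity), ENNReal.ofReal_add (by positivity) (by positivity)]
    _ = 1 := by
        rw [lintegral_const_mul _ (show Measurable fun r : ℝ =>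
            ENNReal.ofReal (1 / √((1 - r) * (r + μ))) +
              ENNReal.ofReal (1 / √((1 - r) * (r + μ⁻¹))) from (hm _).add (hm _)),
          lintegral_add_left (hm _),
          lintegral_harmonic_half hμ, lintegral_harmonic_half (inv_pos.mpr hμ),
          ← ENNReal.ofReal_add (by linarith [hle ((μ - 1) / (1 + μ))])
            (by linarith [hle ((μ⁻¹ - 1) / (1 + μ⁻¹))]),
          show (μ⁻¹ - 1) / (1 + μ⁻¹) = -((μ - 1) / (1 + μ)) by field_simp; ring,
          Real.arcsin_neg, ← ENNReal.ofReal_mul (by positivity), ← ENNReal.ofReal_one]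
        congr 1
        field_simp
        ring

theorem lintegral_Ioo_const_mul {b : ℝ} (hb : 0 < b) (f : ℝ → ENNReal) :
    ∫⁻ s in Ioo 0 b, f s = ∫⁻ r in Ioo (0 : ℝ) 1, ENNReal.ofReal b * f (b * r) := by
  have h := lintegral_image_eq_lintegral_abs_deriv_mul (f := fun r => b * r) (f' := fun _ => b)
    (s := Ioo (0 : ℝ) 1) measurableSet_Ioo
    (fun x _ => by simpa using ((hasDerivAt_id x).const_mul b).hasDerivWithinAt)
    ((mul_right_injective₀ hb.ne').injOn) f
  rw [image_mul_left_Ioo hb] at h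
  simpa [abs_of_pos hb] using h

theorem lintegral_Ioo_neg_const_mul {b : ℝ} (hb : 0 < b) (f : ℝ → ENNReal) :
    ∫⁻ s in Ioo (-b) 0, f s = ∫⁻ r in Ioo (0 : ℝ) 1, ENNReal.ofReal b * f (-(b * r)) := by
  have h := lintegral_image_eq_lintegral_abs_deriv_mul (f := fun r => -r) (f' := fun _ => -1)
    (s := Ioo (0 : ℝ) b) measurableSet_Ioo
    (fun x _ => (hasDerivAt_neg x).hasDerivWithinAt) neg_injective.injOn f
  rw [image_neg_eq_neg, Set.neg_Ioo, neg_zero] at h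
  rw [h, lintegral_Ioo_const_mul hb]
  simp

/-- The time of half an oscillation between the turning points `-a` and `b` exceeds `1`. -/
theorem one_lt_lintegral_inv_speed {q k E a b : ℝ} (hq1 : 1 < q) (hq2 : q ≤ 2) (hk : 0 < k)
    (ha : 0 < a) (hb : 0 < b) (hWb : potential q k b = E) (hWa : potential q k (-a) = E) :
    1 < ∫⁻ s in Ioo (-a) b, ENNReal.ofReal (1 / speed q k E s) := by
  have hπ := Real.pi_pos
  have haq : 0 < a ^ q := Real.rpow_pos_of_pos ha q
  have hbq : 0 < b ^ q := Real.rpow_pos_of_pos hb q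
  rw [potential_of_nonneg hq1.le k hb.le] at hWb
  rw [potential_neg, signedPow_of_nonneg hq1.le ha.le] at hWa
  set μ := a / b with hμ
  have hab : a < b := by
    have : 0 < Real.pi ^ 2 * (b ^ 2 - a ^ 2) := by nlinarith
    have := pos_of_mul_pos_right this (by positivity)
    nlinarith
  have hμ0 : 0 < μ := div_pos ha hb
  have hμ1 : μ < 1 := (div_lt_one hb).mpr hab
  have hμq : μ ^ q = a ^ q / b ^ q := Real.div_rpow ha.le hb.le q
  set z := (1 - μ ^ 2) / (1 + μ ^ q) with hz
  have hzk : Real.pi ^ 2 * b ^ 2 * z = k * b ^ q := by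
    rw [hz, hμq, hμ]
    field_simp
    linarith
  have hzk' : Real.pi ^ 2 * a ^ 2 * (z * μ ^ (q - 2)) = k * a ^ q := by
    have e : μ ^ (q - 2) = μ ^ q / μ ^ 2 := by
      rw [Real.rpow_sub hμ0]; simp
    calc _ = Real.pi ^ 2 * b ^ 2 * z * (a ^ q / b ^ q) := by
          rw [e, hμq, hμ]; field_simp
      _ = _ := by rw [hzk]; field_simp
  -- The heights `b r` and `-a r` on both sides of `0` are parametrised by the same `r`.
  have hsplit : ∫⁻ r in Ioo (0 : ℝ) 1, ENNReal.ofReal (Real.pi⁻¹ *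
      (1 / √(1 - r ^ 2 - z * (1 - r ^ q)) + 1 / √(1 - r ^ 2 + z * μ ^ (q - 2) * (1 - r ^ q)))) =
      (∫⁻ s in Ioo 0 b, ENNReal.ofReal (1 / speed q k E s)) +
        ∫⁻ s in Ioo (-a) 0, ENNReal.ofReal (1 / speed q k E s) := by
    have hms : Measurable fun s => ENNReal.ofReal (1 / speed q k E s) := by
      have := (continuous_speed hq1.le k E).measurable
      fun_prop
    rw [lintegral_Ioo_const_mul hb, lintegral_Ioo_neg_const_mul ha,
      ← lintegral_add_left (show Measurable fun r => ENNReal.ofReal b *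
        ENNReal.ofReal (1 / speed q k E (b * r)) from
          (hms.comp (measurable_const_mul b)).const_mul _)]
    refine setLIntegral_congr_fun measurableSet_Ioo fun r hr => ?_
    have hr0 : 0 ≤ r := hr.1.le
    rw [← ENNReal.ofReal_mul hb.le, ← ENNReal.ofReal_mul ha.le,
      ← ENNReal.ofReal_add (mul_nonneg hb.le (one_div_nonneg.mpr (speed_nonneg _ _ _ _)))
        (mul_nonneg ha.le (one_div_nonneg.mpr (speed_nonneg _ _ _ _)))]
    congr 1
    have e1 : speed q k E (b * r) = Real.pi * b * √(1 - r ^ 2 - z * (1 - r ^ q)) := by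
      rw [speed, potential_of_nonneg hq1.le k (by positivity), Real.mul_rpow hb.le hr0, ← hWb,
        show Real.pi ^ 2 * b ^ 2 - k * b ^ q - (Real.pi ^ 2 * (b * r) ^ 2 - k * (b ^ q * r ^ q)) =
          (Real.pi * b) ^ 2 * (1 - r ^ 2 - z * (1 - r ^ q)) by
            linear_combination (1 - r ^ q) * hzk,
        Real.sqrt_mul (by positivity), Real.sqrt_sq (by positivity)]
    have e2 : speed q k E (-(a * r)) =
        Real.pi * a * √(1 - r ^ 2 + z * μ ^ (q - 2) * (1 - r ^ q)) := by
      rw [speed, potential_neg, signedPow_of_nonneg hq1.le (by positivity),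
        Real.mul_rpow ha.le hr0, ← hWa,
        show Real.pi ^ 2 * a ^ 2 + k * a ^ q - (Real.pi ^ 2 * (a * r) ^ 2 + k * (a ^ q * r ^ q)) =
          (Real.pi * a) ^ 2 * (1 - r ^ 2 + z * μ ^ (q - 2) * (1 - r ^ q)) by
            linear_combination -(1 - r ^ q) * hzk',
        Real.sqrt_mul (by positivity), Real.sqrt_sq (by positivity)]
    rw [e1, e2]
    simp only [one_div, mul_inv]
    field_simp
  calc (1 : ENNReal) = _ := (lintegral_harmonic hμ0).symm
    _ < _ := by
        refine setLIntegral_strict_mono measurableSet_Ioo (by simp) ?_ ?_ ?_ (g := fun r =>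
          ENNReal.ofReal (Real.pi⁻¹ * (1 / √(1 - r ^ 2 - z * (1 - r ^ q)) +
            1 / √(1 - r ^ 2 + z * μ ^ (q - 2) * (1 - r ^ q)))))
        · fun_prop
        · rw [lintegral_harmonic hμ0]; exact ENNReal.one_ne_top
        · refine Filter.Eventually.of_forall fun r hr => ?_
          have h := period_integrand_lt hq1 hq2 hμ0 hμ1 hr.1 hr.2 hz
          have h0 : 0 ≤ 1 / √((1 - r) * (r + μ)) + 1 / √((1 - r) * (r + μ⁻¹)) := by positivity
          rw [ENNReal.ofReal_lt_ofReal_iff (mul_pos (by positivity) (h0.trans_lt h))]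
          gcongr
    _ = _ := hsplit
    _ = ∫⁻ s in Ioo 0 b ∪ Ioo (-a) 0, ENNReal.ofReal (1 / speed q k E s) := by
        rw [lintegral_union measurableSet_Ioo]
        rw [Set.disjoint_left]
        intro x hx hx'
        exact absurd hx.1 (not_lt.mpr hx'.2.le)
    _ ≤ _ := by
        refine lintegral_mono_set (union_subset ?_ ?_)
        · exact Ioo_subset_Ioo (by linarith) le_rfl
        · exact Ioo_subset_Ioo le_rfl hb.le

/-- The antiderivative `2 √(E - w)` is monotone and flat below `w`, where `1 / √(E - w)` is `1 / 0`
and counts as `0`. -/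
theorem lintegral_inv_sqrt_le (w : ℝ) {E₁ E₂ : ℝ} (hE : E₁ ≤ E₂) :
    ∫⁻ E in Ioo E₁ E₂, ENNReal.ofReal (1 / √(E - w)) ≤
      ENNReal.ofReal (2 * √(E₂ - w) - 2 * √(E₁ - w)) := by
  set F : ℝ → ℝ := fun E => 2 * √(E - w)
  have hmono : MonotoneOn F (uIcc E₁ E₂) := fun x _ y _ hxy => by
    simp only [F]; gcongr
  have hd : ∀ E, E ≠ w → deriv F E = 1 / √(E - w) := by
    intro E hEw
    have := (((hasDerivAt_id E).sub_const w).sqrt (sub_ne_zero.mpr hEw)).const_mul 2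
    have h : deriv F E = 2 * (1 / (2 * √(E - w))) := this.deriv
    rw [h]
    field_simp
  have hint := hmono.intervalIntegrable_deriv
  have hle := hmono.intervalIntegral_deriv_mem_uIcc
  have hF : F E₁ ≤ F E₂ := hmono left_mem_uIcc right_mem_uIcc hE
  rw [uIcc_of_le (sub_nonneg.mpr hF)] at hle
  have hae : ∀ᵐ E ∂(volume.restrict (Ioo E₁ E₂)), deriv F E = 1 / √(E - w) := by
    refine ae_restrict_of_ae ?_
    filter_upwards [compl_mem_ae_iff.mpr (measure_singleton w)] with E hE
    exact hd E hE
  rw [intervalIntegrable_iff_integrableOn_Ioo_of_le hE] at hint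
  rw [intervalIntegral.integral_of_le hE, integral_Ioc_eq_integral_Ioo] at hle
  calc _ = ∫⁻ E in Ioo E₁ E₂, ENNReal.ofReal (deriv F E) := by
        refine lintegral_congr_ae ?_
        filter_upwards [hae] with E hE
        rw [hE]
    _ = ENNReal.ofReal (∫ E in Ioo E₁ E₂, deriv F E) := by
        rw [ofReal_integral_eq_lintegral_ofReal hint]
        filter_upwards [hae] with E hE
        rw [hE, Pi.zero_apply]
        positivity
    _ ≤ _ := ENNReal.ofReal_le_ofReal hle.2

/-- The action `4 ∫ √(E - W) - 2E` of a full oscillation is strictly increasing in the energy,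
since its derivative is the period minus `2`. -/
theorem action_lt {q k m M E₁ E₂ : ℝ} (hq1 : 1 < q) (hq2 : q ≤ 2) (hk : 0 < k) (hm : 0 < m)
    (hM : 0 < M) (hE₁ : 0 ≤ E₁) (hE : E₁ < E₂) (hWM : potential q k M = E₂)
    (hWm : potential q k (-m) = E₂) :
    4 * (∫ s in (-m)..M, speed q k E₁ s) - 2 * E₁ <
      4 * (∫ s in (-m)..M, speed q k E₂ s) - 2 * E₂ := by
  have hmM : -m ≤ M := by linarith
  have hW := continuous_potential hq1.le k
  have hmeas : Measurable fun p : ℝ × ℝ => ENNReal.ofReal (1 / √(p.1 - potential q k p.2)) := by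
    have := hW.measurable
    fun_prop
  have htime : ∀ E ∈ Ioo E₁ E₂,
      1 < ∫⁻ s in Ioo (-m) M, ENNReal.ofReal (1 / √(E - potential q k s)) := by
    intro E hEm
    have h0 : 0 < E := hE₁.trans_lt hEm.1
    obtain ⟨b, hb, hbE⟩ := intermediate_value_Icc hM.le hW.continuousOn
      (show E ∈ Icc (potential q k 0) (potential q k M) by
        rw [potential_zero, hWM]; exact ⟨h0.le, hEm.2.le⟩)
    obtain ⟨a, ha, haE⟩ := intermediate_value_Icc hm.le
      (hW.comp continuous_neg).continuousOn
      (show E ∈ Icc (potential q k (-0)) (potential q k (-m)) by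
        rw [neg_zero, potential_zero, hWm]; exact ⟨h0.le, hEm.2.le⟩)
    have hb0 : 0 < b := hb.1.lt_of_ne (by
      rintro rfl; rw [potential_zero] at hbE; exact h0.ne hbE)
    have ha0 : 0 < a := ha.1.lt_of_ne (by
      rintro rfl; simp only [Function.comp, neg_zero, potential_zero] at haE; exact h0.ne haE)
    refine (one_lt_lintegral_inv_speed hq1 hq2 hk ha0 hb0 hbE haE).trans_le ?_
    exact lintegral_mono_set (Ioo_subset_Ioo (neg_le_neg ha.2) hb.2)
  have hD : Continuous fun s => 2 * speed q k E₂ s - 2 * speed q k E₁ s :=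
    ((continuous_speed hq1.le k E₂).const_mul 2).sub ((continuous_speed hq1.le k E₁).const_mul 2)
  have hD0 : ∀ s, 0 ≤ 2 * speed q k E₂ s - 2 * speed q k E₁ s := by
    intro s
    have : speed q k E₁ s ≤ speed q k E₂ s := Real.sqrt_le_sqrt (by linarith)
    linarith
  -- The half-period is integrated over the energy by Tonelli's theorem, so that neither its
  -- finiteness nor differentiation under the integral sign is needed.
  have key : ENNReal.ofReal (E₂ - E₁) <
      ENNReal.ofReal (∫ s in (-m)..M, (2 * speed q k E₂ s - 2 * speed q k E₁ s)) := by
    calc ENNReal.ofReal (E₂ - E₁) = ∫⁻ _ in Ioo E₁ E₂, 1 := by simp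
      _ < ∫⁻ E in Ioo E₁ E₂, ∫⁻ s in Ioo (-m) M,
          ENNReal.ofReal (1 / √(E - potential q k s)) := by
          refine setLIntegral_strict_mono measurableSet_Ioo (by simp [hE]) ?_ (by simp) ?_
          · exact hmeas.lintegral_prod_right'
          · exact Filter.Eventually.of_forall htime
      _ = ∫⁻ s in Ioo (-m) M, ∫⁻ E in Ioo E₁ E₂,
          ENNReal.ofReal (1 / √(E - potential q k s)) :=
          lintegral_lintegral_swap hmeas.aemeasurable
      _ ≤ ∫⁻ s in Ioo (-m) M, ENNReal.ofReal (2 * speed q k E₂ s - 2 * speed q k E₁ s) :=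
          lintegral_mono fun s => lintegral_inv_sqrt_le _ hE.le
      _ = _ := by
          rw [intervalIntegral.integral_of_le hmM, integral_Ioc_eq_integral_Ioo,
            ofReal_integral_eq_lintegral_ofReal]
          · exact hD.integrableOn_Icc.mono_set Ioo_subset_Icc_self
          · exact Filter.Eventually.of_forall hD0
  rw [ENNReal.ofReal_lt_ofReal_iff_of_nonneg (by linarith)] at key
  rw [intervalIntegral.integral_sub
      (((continuous_speed hq1.le k E₂).const_mul 2).intervalIntegrable _ _)
      (((continuous_speed hq1.le k E₁).const_mul 2).intervalIntegrable _ _),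
    intervalIntegral.integral_const_mul, intervalIntegral.integral_const_mul] at key
  linarith

/-! ### Extremal functions of a definite shape -/

/-- A motion with speed `π √(1 - v²)` from `0` to `1` takes at least the time `1/2` and begins
like `sin (π t)`. -/
theorem eq_sin_of_sub_eq_integral {v : ℝ → ℝ} {L : ℝ} (hL : 0 ≤ L) (hv : ContinuousOn v (Icc 0 L))
    (h0 : v 0 = 0) (h1 : v L = 1)
    (hint : ∀ c ∈ Icc 0 L, ∀ d ∈ Icc 0 L, v d - v c = ∫ t in c..d, Real.pi * √(1 - v t ^ 2)) :
    1 / 2 ≤ L ∧ ∀ t ∈ Icc (0 : ℝ) (1 / 2), v t = Real.sin (Real.pi * t) := by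
  have hπ := Real.pi_pos
  have hmono : ∀ c ∈ Icc 0 L, ∀ d ∈ Icc 0 L, c ≤ d → v c ≤ v d := by
    intro c hc d hd hcd
    have := intervalIntegral.integral_nonneg (μ := volume) hcd
      (fun t _ => show 0 ≤ Real.pi * √(1 - v t ^ 2) by positivity)
    linarith [hint c hc d hd]
  have hK : IsCompact (Icc 0 L ∩ v ⁻¹' {1}) :=
    isCompact_Icc.of_isClosed_subset (hv.preimage_isClosed_of_isClosed isClosed_Icc
      isClosed_singleton) inter_subset_left
  have hKn : (Icc 0 L ∩ v ⁻¹' {1}).Nonempty := ⟨L, ⟨hL, le_rfl⟩, h1⟩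
  set p := sInf (Icc 0 L ∩ v ⁻¹' {1}) with hp
  obtain ⟨hpL, hvp⟩ : p ∈ Icc 0 L ∩ v ⁻¹' {1} := hK.sInf_mem hKn
  have hvp : v p = 1 := hvp
  have hlt : ∀ t ∈ Ico 0 p, v t < 1 := by
    intro t ht
    have htL : t ∈ Icc 0 L := ⟨ht.1, ht.2.le.trans hpL.2⟩
    refine lt_of_le_of_ne (h1 ▸ hmono t htL L ⟨hL, le_rfl⟩ htL.2) fun h => ?_
    exact absurd (csInf_le hK.bddBelow ⟨htL, h⟩) (not_le.mpr ht.2)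
  have hcg : ContinuousOn (fun t => Real.pi * √(1 - v t ^ 2)) (Icc 0 L) := by fun_prop
  have hd : ∀ t ∈ Ioo 0 p, HasDerivAt (fun t => Real.arcsin (v t)) Real.pi t := by
    intro t ht
    have htL : t ∈ Ioo 0 L := ⟨ht.1, ht.2.trans_le hpL.2⟩
    have hvt0 : 0 ≤ v t := h0 ▸ hmono 0 ⟨le_rfl, hL⟩ t ⟨htL.1.le, htL.2.le⟩ htL.1.le
    have hvt1 := hlt t ⟨ht.1.le, ht.2⟩
    have hF : HasDerivAt (fun t => ∫ s in (0 : ℝ)..t, Real.pi * √(1 - v s ^ 2))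
        (Real.pi * √(1 - v t ^ 2)) t := by
      refine intervalIntegral.integral_hasDerivAt_right ?_ ?_ ?_
      · refine (hcg.mono ?_).intervalIntegrable
        exact uIcc_subset_Icc ⟨le_rfl, hL⟩ ⟨htL.1.le, htL.2.le⟩
      · exact (hcg.mono Ioo_subset_Icc_self).stronglyMeasurableAtFilter isOpen_Ioo t htL
      · exact hcg.continuousAt (Icc_mem_nhds htL.1 htL.2)
    have hv' : HasDerivAt v (Real.pi * √(1 - v t ^ 2)) t := by
      refine hF.congr_of_eventuallyEq ?_
      filter_upwards [Ioo_mem_nhds htL.1 htL.2] with s hs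
      linarith [hint 0 ⟨le_rfl, hL⟩ s ⟨hs.1.le, hs.2.le⟩]
    refine ((Real.hasDerivAt_arcsin (by linarith) hvt1.ne).comp t hv').congr_deriv ?_
    have : 0 < √(1 - v t ^ 2) := Real.sqrt_pos.mpr (by nlinarith)
    field_simp
  have harc : ∀ t ∈ Icc 0 p, Real.arcsin (v t) = Real.pi * t := by
    intro t ht
    have h := intervalIntegral.integral_eq_sub_of_hasDerivAt_of_le ht.1
      (f := fun t => Real.arcsin (v t)) (f' := fun _ => Real.pi)
      (Real.continuous_arcsin.comp_continuousOn
        (hv.mono (Icc_subset_Icc le_rfl (ht.2.trans hpL.2))))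
      (fun s hs => hd s ⟨hs.1, hs.2.trans_le ht.2⟩) intervalIntegrable_const
    simp only [intervalIntegral.integral_const, h0, Real.arcsin_zero, smul_eq_mul] at h
    linarith
  have hp2 : p = 1 / 2 := by
    have := harc p ⟨hpL.1, le_rfl⟩
    rw [hvp, Real.arcsin_one] at this
    have h2 : Real.pi * (p - 1 / 2) = 0 := by linarith
    rcases mul_eq_zero.mp h2 with h | h
    · exact absurd h hπ.ne'
    · linarith
  refine ⟨hp2 ▸ hpL.2, fun t ht => ?_⟩
  rw [← hp2] at ht
  have htL : t ∈ Icc 0 L := ⟨ht.1, ht.2.trans hpL.2⟩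
  rw [← harc t ht, Real.sin_arcsin]
  · linarith [h0 ▸ hmono 0 ⟨le_rfl, hL⟩ t htL ht.1]
  · exact h1 ▸ hmono t htL L ⟨hL, le_rfl⟩ htL.2

namespace MemH01

variable {u : ℝ → ℝ}

/-- The sine is the only function whose extreme values `1` and `-1` are attained in this order
and whose Dirichlet integral is not larger than `π² ∫ u²`. -/
theorem eq_neg_sin (hu : MemH01 u) (hu1 : ∀ x ∈ Icc (-1 : ℝ) 1, |u x| ≤ 1) {a b : ℝ}
    (ha : a ∈ Icc (-1 : ℝ) 1) (hb : b ∈ Icc (-1 : ℝ) 1) (hab : a ≤ b) (hua : u a = 1)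
    (hub : u b = -1)
    (hle : (∫ x in (-1 : ℝ)..1, deriv u x ^ 2) ≤ Real.pi ^ 2 * ∫ x in (-1 : ℝ)..1, u x ^ 2) :
    ∀ x ∈ Icc (-1 : ℝ) 1, u x = -Real.sin (Real.pi * x) := by
  have hπ := Real.pi_pos
  have hspeed : ∀ s, speed 1 0 (Real.pi ^ 2) s = Real.pi * √(1 - s ^ 2) := by
    intro s
    rw [speed, potential, show Real.pi ^ 2 - (Real.pi ^ 2 * s ^ 2 - 0 * signedPow 1 s) =
      Real.pi ^ 2 * (1 - s ^ 2) by ring, Real.sqrt_mul (by positivity), Real.sqrt_sq hπ.le]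
  have hE : ∀ x ∈ Icc (-1 : ℝ) 1, potential 1 0 (u x) ≤ Real.pi ^ 2 := by
    intro x hx
    have : u x ^ 2 ≤ 1 := by rw [← sq_abs]; exact pow_le_one₀ (abs_nonneg _) (hu1 x hx)
    rw [potential]
    nlinarith [mul_le_mul_of_nonneg_left this (sq_nonneg Real.pi)]
  have h := hu.calibration_potential le_rfl hE (σ := 1) (by norm_num) ha hb
  have hI : ∫ s in (-1 : ℝ)..1, speed 1 0 (Real.pi ^ 2) s = Real.pi * (Real.pi / 2) := by
    simp_rw [hspeed]
    rw [intervalIntegral.integral_const_mul, integral_sqrt_one_sub_sq]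
  rw [hua, hub, hI] at h
  have n1 := intervalIntegral.integral_nonneg (μ := volume) ha.1
    (fun x _ => sq_nonneg (deriv u x - 1 * speed 1 0 (Real.pi ^ 2) (u x)))
  have n2 := intervalIntegral.integral_nonneg (μ := volume) hab
    (fun x _ => sq_nonneg (deriv u x - (-1) * speed 1 0 (Real.pi ^ 2) (u x)))
  have n3 := intervalIntegral.integral_nonneg (μ := volume) hb.2
    (fun x _ => sq_nonneg (deriv u x - 1 * speed 1 0 (Real.pi ^ 2) (u x)))
  have hg := continuous_speed (le_refl (1 : ℝ)) 0 (Real.pi ^ 2)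
  have f1 := fun {c d : ℝ} => hu.sub_eq_integral_of_integral_sq_eq_zero hg (σ := 1) le_rfl ha.1
    ha.2 (by linarith) (c := c) (d := d)
  have f2 := fun {c d : ℝ} => hu.sub_eq_integral_of_integral_sq_eq_zero hg (σ := -1) ha.1 hab
    hb.2 (by linarith) (c := c) (d := d)
  have f3 := fun {c d : ℝ} => hu.sub_eq_integral_of_integral_sq_eq_zero hg (σ := 1) hb.1 hb.2
    le_rfl (by linarith) (c := c) (d := d)
  simp only [hspeed] at f1 f2 f3
  obtain ⟨z, hz, huz⟩ : ∃ z ∈ Icc a b, u z = 0 :=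
    intermediate_value_Icc' hab (hu.continuousOn.mono (Icc_subset_Icc ha.1 hb.2))
      (show (0 : ℝ) ∈ Icc (u b) (u a) by rw [hua, hub]; norm_num)
  have hcont := hu.continuousOn
  -- The four quarters of the oscillation, each started at a zero of `u`.
  obtain ⟨l1, s1⟩ := eq_sin_of_sub_eq_integral (v := fun t => u (-1 + t)) (L := a + 1)
    (by linarith [ha.1])
    (hcont.comp (by fun_prop) fun t ht => ⟨by linarith [ht.1], by linarith [ht.2, ha.2]⟩)
    (by simp [hu.left_eq_zero]) (by simp [hua]) (by
      intro c hc d hd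
      rw [intervalIntegral.integral_comp_add_left (fun x => Real.pi * √(1 - u x ^ 2)),
        f1 ⟨by linarith [hc.1], by linarith [hc.2]⟩ ⟨by linarith [hd.1], by linarith [hd.2]⟩,
        one_mul])
  obtain ⟨l2, s2⟩ := eq_sin_of_sub_eq_integral (v := fun t => u (z - t)) (L := z - a)
    (by linarith [hz.1])
    (hcont.comp (by fun_prop) fun t ht =>
      ⟨by linarith [ht.2, ha.1], by linarith [ht.1, hz.2, hb.2]⟩)
    (by simp [huz]) (by simp [hua]) (by
      intro c hc d hd
      rw [intervalIntegral.integral_comp_sub_left (fun x => Real.pi * √(1 - u x ^ 2)),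
        intervalIntegral.integral_symm,
        f2 ⟨by linarith [hc.2], by linarith [hc.1, hz.2]⟩
          ⟨by linarith [hd.2], by linarith [hd.1, hz.2]⟩, neg_one_mul])
  obtain ⟨l3, s3⟩ := eq_sin_of_sub_eq_integral (v := fun t => -u (z + t)) (L := b - z)
    (by linarith [hz.2])
    (hcont.neg.comp (by fun_prop) fun t ht =>
      ⟨by linarith [ht.1, hz.1, ha.1], by linarith [ht.2, hb.2]⟩)
    (by simp [huz]) (by simp [hub]) (by
      intro c hc d hd
      simp only [neg_sq]
      rw [intervalIntegral.integral_comp_add_left (fun x => Real.pi * √(1 - u x ^ 2))]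
      have := f2 (c := z + c) (d := z + d) ⟨by linarith [hc.1, hz.1], by linarith [hc.2]⟩
          ⟨by linarith [hd.1, hz.1], by linarith [hd.2]⟩
      linarith)
  obtain ⟨l4, s4⟩ := eq_sin_of_sub_eq_integral (v := fun t => -u (1 - t)) (L := 1 - b)
    (by linarith [hb.2])
    (hcont.neg.comp (by fun_prop) fun t ht =>
      ⟨by linarith [ht.2, hb.1], by linarith [ht.1]⟩)
    (by simp [hu.right_eq_zero]) (by simp [hub]) (by
      intro c hc d hd
      simp only [neg_sq]
      rw [intervalIntegral.integral_comp_sub_left (fun x => Real.pi * √(1 - u x ^ 2))]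
      have := f3 (c := 1 - d) (d := 1 - c) ⟨by linarith [hd.2], by linarith [hd.1]⟩
          ⟨by linarith [hc.2], by linarith [hc.1]⟩
      linarith)
  -- Four lengths of at least `1/2` fill the interval exactly.
  have hz0 : z = 0 := by linarith
  intro x hx
  rcases le_total x (-1 / 2) with h1 | h1
  · have := s1 (x + 1) ⟨by linarith [hx.1], by linarith⟩
    rw [show -1 + (x + 1) = x by ring, mul_add, mul_one, Real.sin_add_pi] at this
    exact this
  rcases le_total x 0 with h2 | h2
  · have := s2 (-x) ⟨by linarith, by linarith⟩
    rw [hz0, show (0 : ℝ) - -x = x by ring, mul_neg, Real.sin_neg] at this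
    exact this
  rcases le_total x (1 / 2) with h3 | h3
  · have := s3 x ⟨h2, h3⟩
    rw [hz0, zero_add] at this
    linarith
  · have := s4 (1 - x) ⟨by linarith [hx.2], by linarith⟩
    rw [show 1 - (1 - x) = x by ring, mul_sub, mul_one, Real.sin_pi_sub] at this
    linarith

/-- A function that follows the field of a positive energy upwards before `a` and downwards after
`a` leaves its boundary value `0` at once, hence is positive in the interior. -/
theorem pos_of_calibrated (hu : MemH01 u) {q k E a : ℝ} (hq : 1 ≤ q) (hE : 0 < E)
    (ha : a ∈ Icc (-1 : ℝ) 1)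
    (hl : ∫ x in (-1 : ℝ)..a, (deriv u x - 1 * speed q k E (u x)) ^ 2 = 0)
    (hr : ∫ x in a..1, (deriv u x - (-1) * speed q k E (u x)) ^ 2 = 0) :
    ∀ x ∈ Ioo (-1 : ℝ) 1, 0 < u x := by
  have hg := continuous_speed hq k E
  have hc : ContinuousOn (fun x => speed q k E (u x)) (Icc (-1) 1) :=
    hg.comp_continuousOn hu.continuousOn
  have h0 : 0 < speed q k E 0 := by
    rw [speed, potential_zero, sub_zero]; exact Real.sqrt_pos.mpr hE
  intro x hx
  rcases le_total x a with hxa | hxa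
  · have h := hu.sub_eq_integral_of_integral_sq_eq_zero hg le_rfl ha.1 ha.2 hl
      (left_mem_Icc.mpr ha.1) (show x ∈ Icc (-1) a from ⟨hx.1.le, hxa⟩)
    have hpos : 0 < ∫ t in (-1 : ℝ)..x, speed q k E (u t) :=
      intervalIntegral.integral_pos hx.1 (hc.mono (Icc_subset_Icc le_rfl hx.2.le))
        (fun t _ => speed_nonneg _ _ _ _) ⟨-1, left_mem_Icc.mpr hx.1.le, by
          rw [hu.left_eq_zero]; exact h0⟩
    rw [hu.left_eq_zero] at h
    linarith
  · have h := hu.sub_eq_integral_of_integral_sq_eq_zero hg ha.1 ha.2 le_rfl hr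
      (show x ∈ Icc a 1 from ⟨hxa, hx.2.le⟩) (right_mem_Icc.mpr ha.2)
    have hpos : 0 < ∫ t in x..(1 : ℝ), speed q k E (u t) :=
      intervalIntegral.integral_pos hx.2 (hc.mono (Icc_subset_Icc hx.1.le le_rfl))
        (fun t _ => speed_nonneg _ _ _ _) ⟨1, right_mem_Icc.mpr hx.2.le, by
          rw [hu.right_eq_zero]; exact h0⟩
    rw [hu.right_eq_zero] at h
    linarith

end MemH01

/-! ### The sharp inequality for `1 < q ≤ 2` -/

theorem le_rpow_two_div {q t : ℝ} (hq1 : 1 ≤ q) (hq2 : q ≤ 2) (ht : 0 ≤ t) :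
    t ≤ q / 2 * t ^ (2 / q) + (1 - q / 2) := by
  have hq0 : 0 < q := by linarith
  have h := one_add_mul_self_le_rpow_one_add (s := t - 1) (by linarith)
    (show 1 ≤ 2 / q by rw [le_div_iff₀ hq0]; linarith)
  rw [show 1 + (t - 1) = t by ring] at h
  have h2 := mul_le_mul_of_nonneg_left h (show 0 ≤ q / 2 by positivity)
  have e : q / 2 * (1 + 2 / q * (t - 1)) = q / 2 + (t - 1) := by field_simp
  linarith

/-- Young's inequality, arranged so that equality holds for `I = J`. -/
theorem mul_sub_mul_rpow_le {q k J : ℝ} (hq1 : 1 ≤ q) (hq2 : q ≤ 2) (hk : 0 ≤ k) (hJ : 0 < J)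
    (I : ℝ) :
    k * I - q / 2 * k * J ^ (1 - 2 / q) * |I| ^ (2 / q) ≤ (1 - q / 2) * k * J := by
  have h := le_rpow_two_div hq1 hq2 (t := |I| / J) (by positivity)
  rw [Real.div_rpow (abs_nonneg I) hJ.le] at h
  have hkJ : 0 ≤ k * J := by positivity
  have h2 := mul_le_mul_of_nonneg_left h hkJ
  have e1 : k * J * (|I| / J) = k * |I| := by field_simp
  have e2 : J ^ (1 - 2 / q) = J / J ^ (2 / q) := by
    rw [Real.rpow_sub hJ, Real.rpow_one]
  have e3 : k * J * (q / 2 * (|I| ^ (2 / q) / J ^ (2 / q)) + (1 - q / 2)) =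
      q / 2 * k * (J / J ^ (2 / q)) * |I| ^ (2 / q) + (1 - q / 2) * k * J := by ring
  rw [e1, e3] at h2
  rw [e2]
  have h3 : k * I ≤ k * |I| := mul_le_mul_of_nonneg_left (le_abs_self I) hk
  linarith

/-- `mul_sub_mul_rpow_le` for a smaller strength `K` of the nonlinear term, together with the
dilation factor `M` that turns `K` into `k`. For `q = 2` no dilation changes the strength, and `M`
is `0`. -/
theorem exists_dilation {q k J K : ℝ} (hq1 : 1 ≤ q) (hq2 : q ≤ 2) (hJ : 0 < J)
    (hK : 0 < K) (hKk : K < k) :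
    ∃ M : ℝ, 0 ≤ M ∧ M < 1 ∧ K * M ^ q = k * M ^ 2 ∧
      ∀ I : ℝ, K * I - q / 2 * k * J ^ (1 - 2 / q) * |I| ^ (2 / q) ≤
        M ^ 2 * ((1 - q / 2) * k * J) := by
  have hk : 0 < k := hK.trans hKk
  rcases hq2.eq_or_lt with rfl | hq2
  · refine ⟨0, le_rfl, one_pos, by simp, fun I => ?_⟩
    simp only [div_self (two_ne_zero' ℝ), sub_self, Real.rpow_zero, Real.rpow_one]
    have h1 : K * I ≤ K * |I| := mul_le_mul_of_nonneg_left (le_abs_self I) hK.le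
    have h2 : K * |I| ≤ k * |I| := mul_le_mul_of_nonneg_right hKk.le (abs_nonneg I)
    linarith
  · have hKk0 : 0 < K / k := div_pos hK hk
    set M := (K / k) ^ (1 / (2 - q)) with hMdef
    have hM : 0 < M := Real.rpow_pos_of_pos hKk0 _
    have hMq : 0 < M ^ q := Real.rpow_pos_of_pos hM q
    have hM2 : M ^ 2 = K / k * M ^ q := by
      have : M ^ (2 - q) = K / k := by
        rw [hMdef, ← Real.rpow_mul hKk0.le, one_div_mul_cancel (by linarith), Real.rpow_one]
      rw [← this, ← Real.rpow_add hM]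
      simp
    refine ⟨M, hM.le, ?_, ?_, fun I => ?_⟩
    · exact Real.rpow_lt_one hKk0.le ((div_lt_one hk).mpr hKk) (by
        apply one_div_pos.mpr; linarith)
    · rw [hM2]; field_simp
    · have h := mul_sub_mul_rpow_le hq1 hq2.le hk.le hJ (I / M ^ q)
      have e1 : |I / M ^ q| ^ (2 / q) = |I| ^ (2 / q) / M ^ 2 := by
        rw [abs_div, abs_of_pos hMq, Real.div_rpow (abs_nonneg I) hMq.le, ← Real.rpow_mul hM.le,
          mul_div_cancel₀ _ (by linarith)]
        simp
      rw [e1] at h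
      have h2 := mul_le_mul_of_nonneg_left h (sq_nonneg M)
      have e2 : M ^ 2 * (k * (I / M ^ q)) = K * I := by
        rw [hM2]; field_simp
      have e3 : M ^ 2 * (q / 2 * k * J ^ (1 - 2 / q) * (|I| ^ (2 / q) / M ^ 2)) =
          q / 2 * k * J ^ (1 - 2 / q) * |I| ^ (2 / q) := by
        field_simp
      rw [mul_sub, e2, e3] at h2
      exact h2

theorem sq_le_rpow {q s : ℝ} (hq2 : q ≤ 2) (hs0 : 0 ≤ s) (hs1 : s ≤ 1) :
    s ^ 2 ≤ s ^ q := by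
  rcases hs0.eq_or_lt with rfl | hs0
  · simpa using Real.rpow_nonneg le_rfl q
  · rw [← Real.rpow_natCast]
    exact Real.rpow_le_rpow_of_exponent_ge hs0 hs1 (by simpa using hq2)

/-- The interval `[-m, 1]` is accessible with the energy `π² - k` of the turning point `1`, as soon
as its left end point is. -/
theorem potential_le {q k m s : ℝ} (hq1 : 1 ≤ q) (hq2 : q ≤ 2) (hk : 0 ≤ k)
    (hkπ : k ≤ Real.pi ^ 2) (hm : k * (1 + m ^ q) ≤ Real.pi ^ 2 * (1 - m ^ 2))
    (hs : s ∈ Icc (-m) 1) : potential q k s ≤ Real.pi ^ 2 - k := by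
  rcases le_total 0 s with h0 | h0
  · rw [potential_of_nonneg hq1 k h0]
    have h1 := sq_le_rpow hq2 h0 hs.2
    have h2 : s ^ 2 ≤ 1 := pow_le_one₀ h0 hs.2
    nlinarith [mul_nonneg (sub_nonneg.mpr hkπ) (sub_nonneg.mpr h2),
      mul_nonneg hk (sub_nonneg.mpr h1)]
  · obtain ⟨t, rfl⟩ : ∃ t, s = -t := ⟨-s, by ring⟩
    have ht : 0 ≤ t := by linarith
    have htm : t ≤ m := by linarith [hs.1]
    rw [potential_neg, signedPow_of_nonneg hq1 ht]
    have h1 : t ^ q ≤ m ^ q := Real.rpow_le_rpow ht htm (by linarith)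
    have h2 : t ^ 2 ≤ m ^ 2 := pow_le_pow_left₀ ht htm 2
    nlinarith [mul_le_mul_of_nonneg_left h1 hk,
      mul_le_mul_of_nonneg_left h2 (sq_nonneg Real.pi)]

/-- `k` and `J` stem from a positive motion on `[-1,1]` in the potential with turning points `0`
and `1`: `J` plays the role of the integral of the `q`-th power, and the action of the motion is
`(1 - q/2) k J`. -/
structure IsCriticalPair (q k J : ℝ) : Prop where
  k_pos : 0 < k
  k_lt : k < Real.pi ^ 2
  J_pos : 0 < J
  action : 4 * (∫ s in (0 : ℝ)..1, speed q k (Real.pi ^ 2 - k) s) - 2 * (Real.pi ^ 2 - k) =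
    (1 - q / 2) * k * J

theorem integral_speed_dilation {q k K M : ℝ} (hq : 1 ≤ q) (hM : 0 ≤ M)
    (h : K * M ^ q = k * M ^ 2) :
    ∫ s in (0 : ℝ)..M, speed q K (M ^ 2 * (Real.pi ^ 2 - k)) s =
      M ^ 2 * ∫ s in (0 : ℝ)..1, speed q k (Real.pi ^ 2 - k) s := by
  have e := intervalIntegral.mul_integral_comp_mul_left (a := 0) (b := 1)
    (f := speed q K (M ^ 2 * (Real.pi ^ 2 - k))) M
  rw [mul_zero, mul_one] at e
  have e' : M ^ 2 * (∫ s in (0 : ℝ)..1, speed q k (Real.pi ^ 2 - k) s) =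
      M * ∫ s in (0 : ℝ)..1, M * speed q k (Real.pi ^ 2 - k) s := by
    rw [intervalIntegral.integral_const_mul]; ring
  rw [← e, e']
  congr 1
  refine intervalIntegral.integral_congr fun s hs => ?_
  rw [uIcc_of_le zero_le_one] at hs
  rw [speed, speed, potential_of_nonneg hq _ (mul_nonneg hM hs.1), potential_of_nonneg hq _ hs.1,
    Real.mul_rpow hM hs.1,
    show M ^ 2 * (Real.pi ^ 2 - k) - (Real.pi ^ 2 * (M * s) ^ 2 - K * (M ^ q * s ^ q)) =
      M ^ 2 * (Real.pi ^ 2 - k - (Real.pi ^ 2 * s ^ 2 - k * s ^ q)) by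
        linear_combination s ^ q * h,
    Real.sqrt_mul (sq_nonneg M), Real.sqrt_sq hM]

theorem integral_speed_split {q : ℝ} (hq : 1 ≤ q) (k E m M : ℝ) :
    ∫ s in (-m)..M, speed q k E s =
      (∫ s in (-m)..0, speed q k E s) + ∫ s in (0 : ℝ)..M, speed q k E s :=
  (intervalIntegral.integral_add_adjacent_intervals
    ((continuous_speed hq k E).intervalIntegrable _ _)
    ((continuous_speed hq k E).intervalIntegrable _ _)).symm

theorem excess_eq_sub {q : ℝ} (α k : ℝ) (u : ℝ → ℝ) :
    excess α q u =
      (∫ x in (-1 : ℝ)..1, deriv u x ^ 2) - Real.pi ^ 2 * (∫ x in (-1 : ℝ)..1, u x ^ 2) +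
        k * (∫ x in (-1 : ℝ)..1, signedPow q (u x)) -
      (k * (∫ x in (-1 : ℝ)..1, signedPow q (u x)) -
        α * |∫ x in (-1 : ℝ)..1, signedPow q (u x)| ^ (2 / q)) := by
  rw [excess_eq]; ring

namespace IsCriticalPair

variable {q k J : ℝ}

/-- The action of a full oscillation that is weaker than the critical positive motion exceeds the
bound of Young's inequality. -/
theorem lt_action (h : IsCriticalPair q k J) (hq1 : 1 < q) (hq2 : q ≤ 2) {K m : ℝ}
    (hK : 0 < K) (hKk : K < k) (hm : 0 < m)
    (hmK : K * (1 + m ^ q) = Real.pi ^ 2 * (1 - m ^ 2)) (I : ℝ) :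
    K * I - q / 2 * k * J ^ (1 - 2 / q) * |I| ^ (2 / q) <
      4 * (∫ s in (-m)..1, speed q K (Real.pi ^ 2 - K) s) - 2 * (Real.pi ^ 2 - K) := by
  obtain ⟨M, hM0, hM1, hKM, hY⟩ := exists_dilation hq1.le hq2 h.J_pos hK hKk
  have hM2 : M ^ 2 ≤ 1 := pow_le_one₀ hM0 hM1.le
  have hπk : 0 < Real.pi ^ 2 - k := sub_pos.mpr h.k_lt
  have hlt := action_lt hq1 hq2 hK hm one_pos (E₁ := M ^ 2 * (Real.pi ^ 2 - k))
    (E₂ := Real.pi ^ 2 - K) (by positivity) (by nlinarith)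
    (by rw [potential_of_nonneg hq1.le K zero_le_one]; simp)
    (by rw [potential_neg, signedPow_of_nonneg hq1.le hm.le]; linarith)
  have hmono : ∫ s in (0 : ℝ)..M, speed q K (M ^ 2 * (Real.pi ^ 2 - k)) s ≤
      ∫ s in (-m)..1, speed q K (M ^ 2 * (Real.pi ^ 2 - k)) s :=
    intervalIntegral.integral_mono_interval (by linarith) hM0 hM1.le
      (Filter.Eventually.of_forall fun s => speed_nonneg _ _ _ _)
      ((continuous_speed hq1.le K _).intervalIntegrable _ _)
  rw [integral_speed_dilation hq1.le hM0 hKM] at hmono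
  have := hY I
  rw [← h.action] at this
  linarith

/-- The sharp inequality, with the cases of equality, for a function normalised to have maximum
`1` and minimum `-m ≥ -1`. -/
theorem excess_nonneg_of_normalised (h : IsCriticalPair q k J) (hq1 : 1 < q) (hq2 : q ≤ 2)
    {u : ℝ → ℝ} (hu : MemH01 u) {m : ℝ} (hm : m ∈ Icc (0 : ℝ) 1)
    (hr : ∀ x ∈ Icc (-1 : ℝ) 1, u x ∈ Icc (-m) 1) (hmax : ∃ x ∈ Icc (-1 : ℝ) 1, u x = 1)
    (hmin : ∃ x ∈ Icc (-1 : ℝ) 1, u x = -m) :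
    0 ≤ excess (q / 2 * k * J ^ (1 - 2 / q)) q u ∧
      (excess (q / 2 * k * J ^ (1 - 2 / q)) q u = 0 →
        (∀ x ∈ Ioo (-1 : ℝ) 1, 0 < u x) ∨
        ∃ C : ℝ, C ≠ 0 ∧ ∀ x ∈ Icc (-1 : ℝ) 1, u x = C * Real.sin (Real.pi * x)) := by
  have hπ := Real.pi_pos
  have hk := h.k_pos
  have hJ := h.J_pos
  set I := ∫ x in (-1 : ℝ)..1, signedPow q (u x) with hI
  set α := q / 2 * k * J ^ (1 - 2 / q) with hα
  have hα0 : 0 ≤ α := by positivity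
  have hmq0 : 0 ≤ m ^ q := Real.rpow_nonneg hm.1 q
  rcases le_or_gt (k * (1 + m ^ q)) (Real.pi ^ 2 * (1 - m ^ 2)) with hA | hB
  · have hE : ∀ x ∈ Icc (-1 : ℝ) 1, potential q k (u x) ≤ Real.pi ^ 2 - k := fun x hx =>
      potential_le hq1.le hq2 hk.le h.k_lt.le hA (hr x hx)
    have hY := mul_sub_mul_rpow_le hq1.le hq2 hk.le hJ I
    rw [← hα] at hY
    have hact := h.action
    rcases hm.1.eq_or_lt with hm0 | hm0
    · obtain ⟨a, ha, hua⟩ := hmax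
      have hcal := hu.calibration_potential hq1.le hE (σ := 1) (by norm_num) ha
        (show (1 : ℝ) ∈ Icc (-1 : ℝ) 1 by norm_num)
      rw [hua, hu.right_eq_zero, intervalIntegral.integral_same (a := (1 : ℝ)), ← hI] at hcal
      have n1 := intervalIntegral.integral_nonneg (μ := volume) ha.1
        (fun x _ => sq_nonneg (deriv u x - 1 * speed q k (Real.pi ^ 2 - k) (u x)))
      have n2 := intervalIntegral.integral_nonneg (μ := volume) ha.2
        (fun x _ => sq_nonneg (deriv u x - (-1) * speed q k (Real.pi ^ 2 - k) (u x)))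
      rw [excess_eq_sub α k, ← hI]
      refine ⟨by linarith, fun h0 => Or.inl ?_⟩
      exact hu.pos_of_calibrated hq1.le (sub_pos.mpr h.k_lt) ha (by linarith) (by linarith)
    · have hlow := hu.lower_bound hq1.le hE hmax hmin
      rw [integral_speed_split hq1.le, ← hI] at hlow
      have hpos : 0 < ∫ s in (-m)..0, speed q k (Real.pi ^ 2 - k) s := by
        refine intervalIntegral.integral_pos (by linarith)
          (continuous_speed hq1.le _ _).continuousOn (fun s _ => speed_nonneg _ _ _ _)
          ⟨0, ⟨by linarith, le_rfl⟩, ?_⟩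
        rw [speed, potential_zero, sub_zero]
        exact Real.sqrt_pos.mpr (sub_pos.mpr h.k_lt)
      have : 0 < excess α q u := by
        rw [excess_eq_sub α k, ← hI]; linarith
      exact ⟨this.le, fun h0 => absurd h0 this.ne'⟩
  · have hm0 : 0 < m := by
      refine hm.1.lt_of_ne ?_
      rintro rfl
      rw [Real.zero_rpow (by linarith)] at hB
      nlinarith [h.k_lt]
    rcases hm.2.eq_or_lt with hm1 | hm1
    · subst hm1
      have hE : ∀ x ∈ Icc (-1 : ℝ) 1, potential q 0 (u x) ≤ Real.pi ^ 2 - 0 := fun x hx =>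
        potential_le hq1.le hq2 le_rfl (sq_nonneg _) (by norm_num) (hr x hx)
      have hlow := hu.lower_bound hq1.le hE hmax hmin
      have hS : ∫ s in (-1 : ℝ)..1, speed q 0 (Real.pi ^ 2 - 0) s =
          Real.pi * (Real.pi / 2) := by
        rw [← integral_sqrt_one_sub_sq, ← intervalIntegral.integral_const_mul]
        refine intervalIntegral.integral_congr fun s _ => ?_
        rw [speed, potential,
          show Real.pi ^ 2 - 0 - (Real.pi ^ 2 * s ^ 2 - 0 * signedPow q s) =
            Real.pi ^ 2 * (1 - s ^ 2) by ring, Real.sqrt_mul (by positivity), Real.sqrt_sq hπ.le]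
      rw [hS] at hlow
      have hp : 0 ≤ α * |I| ^ (2 / q) := by positivity
      rw [excess_eq, ← hI]
      refine ⟨by linarith, fun h0 => Or.inr ?_⟩
      have hle : (∫ x in (-1 : ℝ)..1, deriv u x ^ 2) ≤
          Real.pi ^ 2 * ∫ x in (-1 : ℝ)..1, u x ^ 2 := by linarith
      have habs : ∀ x ∈ Icc (-1 : ℝ) 1, |u x| ≤ 1 := fun x hx => abs_le.mpr (hr x hx)
      obtain ⟨a, ha, hua⟩ := hmax
      obtain ⟨b, hb, hub⟩ := hmin
      rcases le_total a b with hab | hab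
      · refine ⟨-1, by norm_num, fun x hx => ?_⟩
        rw [hu.eq_neg_sin habs ha hb hab hua hub hle x hx]; ring
      · refine ⟨1, by norm_num, fun x hx => ?_⟩
        have := (hu.const_mul (-1)).eq_neg_sin (by simpa using habs) hb ha hab (by simp [hub])
          (by simp [hua]) (by simpa using hle) x hx
        linarith
    · -- The strength for which `-m` and `1` are the turning points of one motion.
      set K := Real.pi ^ 2 * (1 - m ^ 2) / (1 + m ^ q) with hKdef
      have hmK : K * (1 + m ^ q) = Real.pi ^ 2 * (1 - m ^ 2) := by
        rw [hKdef]; field_simp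
      have hKk : K < k := by rw [hKdef, div_lt_iff₀ (by linarith)]; exact hB
      have hK : 0 < K := by
        rw [hKdef]
        have : 0 < 1 - m ^ 2 := by nlinarith
        positivity
      have hE : ∀ x ∈ Icc (-1 : ℝ) 1, potential q K (u x) ≤ Real.pi ^ 2 - K := fun x hx =>
        potential_le hq1.le hq2 hK.le (hKk.trans h.k_lt).le hmK.le (hr x hx)
      have hlow := hu.lower_bound hq1.le hE hmax hmin
      have hlt := h.lt_action hq1 hq2 hK hKk hm0 hmK I
      rw [← hI] at hlow
      rw [← hα] at hlt
      have : 0 < excess α q u := by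
        rw [excess_eq_sub α K, ← hI]; linarith
      exact ⟨this.le, fun h0 => absurd h0 this.ne'⟩

/-- The sharp inequality for all functions of `H₀¹(-1,1)`, with the cases of equality. -/
theorem excess_nonneg (h : IsCriticalPair q k J) (hq1 : 1 < q) (hq2 : q ≤ 2)
    {u : ℝ → ℝ} (hu : u ∈ admissible) :
    0 ≤ excess (q / 2 * k * J ^ (1 - 2 / q)) q u ∧
      (excess (q / 2 * k * J ^ (1 - 2 / q)) q u = 0 →
        (∀ x ∈ Ioo (-1 : ℝ) 1, 0 < u x) ∨ (∀ x ∈ Ioo (-1 : ℝ) 1, u x < 0) ∨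
        ∃ C : ℝ, C ≠ 0 ∧ ∀ x ∈ Icc (-1 : ℝ) 1, u x = C * Real.sin (Real.pi * x)) := by
  obtain ⟨c, hc, m, hm, hr, hmax, hmin⟩ := exists_normalised hu
  obtain ⟨h1, h2⟩ := h.excess_nonneg_of_normalised hq1 hq2 (hu.1.const_mul c) hm hr hmax hmin
  rw [excess_const_mul _ hq1.le] at h1 h2
  have hc2 : 0 < c ^ 2 := by positivity
  refine ⟨nonneg_of_mul_nonneg_right h1 hc2, fun h0 => ?_⟩
  rcases h2 (by rw [h0, mul_zero]) with h3 | ⟨C, hC, h3⟩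
  · rcases hc.lt_or_gt with hc | hc
    · exact Or.inr (Or.inl fun x hx => neg_of_mul_pos_right (h3 x hx) hc.le)
    · exact Or.inl fun x hx => pos_of_mul_pos_right (h3 x hx) hc.le
  · refine Or.inr (Or.inr ⟨C / c, div_ne_zero hC hc, fun x hx => ?_⟩)
    have := h3 x hx
    field_simp
    linarith

end IsCriticalPair

/-! ### The critical positive motion -/

/-- The continuous extension of `(1 - t^(q/2)) / (1 - t)` to `t = 1`. -/
def powSlope (q t : ℝ) : ℝ := dslope (fun t : ℝ => t ^ (q / 2)) 1 t

/-- With the height written as `sin θ`, this is `dx/dθ` for a motion with turning point `1`. -/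
def slowness (q k θ : ℝ) : ℝ := 1 / √(Real.pi ^ 2 - k * powSlope q (Real.sin θ ^ 2))

section

variable {q : ℝ}

theorem continuous_powSlope (hq : 0 ≤ q) : Continuous (powSlope q) := by
  rw [← continuousOn_univ]
  refine (continuousOn_dslope Filter.univ_mem).mpr ⟨?_, ?_⟩
  · exact (Real.continuous_rpow_const (by linarith)).continuousOn
  · exact Real.differentiableAt_rpow_const_of_ne _ one_ne_zero

theorem one_sub_mul_powSlope (q t : ℝ) : (1 - t) * powSlope q t = 1 - t ^ (q / 2) := by
  have := sub_smul_dslope (fun t : ℝ => t ^ (q / 2)) 1 t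
  simp only [smul_eq_mul, Real.one_rpow] at this
  rw [powSlope]
  linarith

theorem sq_rpow_half (q : ℝ) {s : ℝ} (hs : 0 ≤ s) : (s ^ 2) ^ (q / 2) = s ^ q := by
  rw [← Real.rpow_natCast, ← Real.rpow_mul hs]
  congr 1
  push_cast
  ring

theorem powSlope_mem_Icc (hq0 : 0 ≤ q) (hq2 : q ≤ 2) {t : ℝ} (ht : t ∈ Icc (0 : ℝ) 1) :
    powSlope q t ∈ Icc (0 : ℝ) 1 := by
  rcases ht.2.eq_or_lt with rfl | ht1
  · have : powSlope q 1 = q / 2 := by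
      rw [powSlope, dslope_same, Real.deriv_rpow_const]
      simp
    rw [this]
    constructor <;> linarith
  · have h := one_sub_mul_powSlope q t
    have h1 : t ^ (q / 2) ≤ 1 := Real.rpow_le_one ht.1 ht.2 (by linarith)
    have h2 : t ≤ t ^ (q / 2) := by
      rcases ht.1.eq_or_lt with rfl | ht0
      · exact Real.rpow_nonneg le_rfl _
      · simpa using Real.rpow_le_rpow_of_exponent_ge ht0 ht.2 (show q / 2 ≤ 1 by linarith)
    constructor <;> nlinarith

theorem sin_sq_mem_Icc (θ : ℝ) : Real.sin θ ^ 2 ∈ Icc (0 : ℝ) 1 :=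
  ⟨sq_nonneg _, Real.sin_sq_le_one θ⟩

theorem sub_mul_powSlope_mem (hq0 : 0 ≤ q) (hq2 : q ≤ 2) {k t : ℝ} (hk0 : 0 ≤ k)
    (ht : t ∈ Icc (0 : ℝ) 1) :
    Real.pi ^ 2 - k * powSlope q t ∈ Icc (Real.pi ^ 2 - k) (Real.pi ^ 2) := by
  obtain ⟨h1, h2⟩ := powSlope_mem_Icc hq0 hq2 ht
  constructor <;> nlinarith

theorem continuous_slowness (hq0 : 0 ≤ q) (hq2 : q ≤ 2) {k : ℝ} (hk0 : 0 ≤ k)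
    (hk : k < Real.pi ^ 2) : Continuous (slowness q k) := by
  have hc := continuous_powSlope hq0
  refine Continuous.div continuous_const (by fun_prop) fun θ => ?_
  have := (sub_mul_powSlope_mem hq0 hq2 hk0 (sin_sq_mem_Icc θ)).1
  exact (Real.sqrt_pos.mpr (by linarith)).ne'

theorem inv_pi_le_slowness (hq0 : 0 ≤ q) (hq2 : q ≤ 2) {k : ℝ} (hk0 : 0 ≤ k)
    (hk : k < Real.pi ^ 2) (θ : ℝ) : 1 / Real.pi ≤ slowness q k θ := by
  obtain ⟨h1, h2⟩ := sub_mul_powSlope_mem hq0 hq2 hk0 (sin_sq_mem_Icc θ)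
  refine one_div_le_one_div_of_le (Real.sqrt_pos.mpr (by linarith)) ?_
  exact (Real.sqrt_le_sqrt h2).trans_eq (Real.sqrt_sq Real.pi_pos.le)

theorem speed_eq_sqrt_mul (hq : 1 ≤ q) (k : ℝ) {s : ℝ} (hs : s ∈ Icc (0 : ℝ) 1) :
    speed q k (Real.pi ^ 2 - k) s =
      √(1 - s ^ 2) * √(Real.pi ^ 2 - k * powSlope q (s ^ 2)) := by
  have h := one_sub_mul_powSlope q (s ^ 2)
  rw [sq_rpow_half q hs.1] at h
  rw [← Real.sqrt_mul (by nlinarith [hs.1, hs.2]), speed, potential_of_nonneg hq k hs.1]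
  congr 1
  linear_combination k * h

/-- In the limit of zero energy the time from height `0` to `1` exceeds `1`, by comparison with
the case `q = 1`. -/
theorem one_lt_lintegral_limit (hq1 : 1 < q) (hq2 : q < 2) :
    1 < ∫⁻ θ in Ioo 0 (Real.pi / 2),
      ENNReal.ofReal (1 / √(Real.pi ^ 2 - Real.pi ^ 2 * powSlope q (Real.sin θ ^ 2))) := by
  have hπ := Real.pi_pos
  set f : ℝ → ℝ := fun θ =>
    Real.pi⁻¹ * (Real.cos θ / √(Real.sin θ * (1 - Real.sin θ))) with hf
  have hsin : ∀ θ ∈ Ioo 0 (Real.pi / 2), 0 < Real.sin θ ∧ Real.sin θ < 1 ∧ 0 < Real.cos θ := by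
    intro θ hθ
    have hc := Real.cos_pos_of_mem_Ioo ⟨by linarith [hθ.1], hθ.2⟩
    have hs := Real.sin_pos_of_mem_Ioo ⟨hθ.1, by linarith [hθ.2]⟩
    refine ⟨hs, ?_, hc⟩
    nlinarith [Real.sin_sq_add_cos_sq θ]
  have h1 : ∫⁻ θ in Ioo 0 (Real.pi / 2), ENNReal.ofReal (f θ) = 1 := by
    rw [lintegral_Ioo_eq_ofReal_sub
      (F := fun θ => Real.pi⁻¹ * Real.arcsin (2 * Real.sin θ - 1)) (by positivity)]
    · rw [← ENNReal.ofReal_one]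
      congr 1
      rw [Real.sin_pi_div_two, Real.sin_zero, show (2 * 1 - 1 : ℝ) = 1 by norm_num,
        show (2 * 0 - 1 : ℝ) = -1 by norm_num, Real.arcsin_one, Real.arcsin_neg_one]
      field_simp
      ring
    · have := Real.continuous_arcsin
      exact Continuous.continuousOn (by fun_prop)
    · intro θ hθ
      obtain ⟨h0, hlt, hc⟩ := hsin θ hθ
      have hin : HasDerivAt (fun θ => 2 * Real.sin θ - 1) (2 * Real.cos θ) θ :=
        ((Real.hasDerivAt_sin θ).const_mul 2).sub_const 1
      refine (((Real.hasDerivAt_arcsin (by linarith) (by linarith)).comp θ hin).const_mul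
        Real.pi⁻¹).congr_deriv ?_
      rw [show 1 - (2 * Real.sin θ - 1) ^ 2 = 2 ^ 2 * (Real.sin θ * (1 - Real.sin θ)) by ring,
        Real.sqrt_mul (by norm_num), Real.sqrt_sq (by norm_num)]
      simp only [hf]
      field_simp
    · intro θ hθ
      obtain ⟨h0, hlt, hc⟩ := hsin θ hθ
      simp only [hf]
      positivity
  calc (1 : ENNReal) = _ := h1.symm
    _ < _ := by
      have hmeas := (continuous_powSlope (show 0 ≤ q by linarith)).measurable
      refine setLIntegral_strict_mono measurableSet_Ioo (by simp [hπ]) (by fun_prop)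
        (by rw [h1]; exact ENNReal.one_ne_top) (Filter.Eventually.of_forall fun θ hθ => ?_)
      obtain ⟨h0, hlt, hc⟩ := hsin θ hθ
      set s := Real.sin θ
      have hcos : Real.cos θ ^ 2 = 1 - s ^ 2 := by
        rw [← Real.sin_sq_add_cos_sq θ]; ring
      have hs2 : 0 < 1 - s ^ 2 := by nlinarith
      have hsl := one_sub_mul_powSlope q (s ^ 2)
      rw [sq_rpow_half q h0.le] at hsl
      have hsq : s ^ q < s := by simpa using Real.rpow_lt_rpow_of_exponent_gt h0 hlt hq1
      have hsq2 : s ^ 2 < s ^ q := by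
        rw [← Real.rpow_natCast]
        exact Real.rpow_lt_rpow_of_exponent_gt h0 hlt (by simpa using hq2)
      have hG : 1 - powSlope q (s ^ 2) = (s ^ q - s ^ 2) / Real.cos θ ^ 2 := by
        rw [hcos, eq_div_iff hs2.ne']; linarith
      have hG0 : 0 < s ^ q - s ^ 2 := by linarith
      have e : √(Real.pi ^ 2 - Real.pi ^ 2 * powSlope q (s ^ 2)) =
          Real.pi * (√(s ^ q - s ^ 2) / Real.cos θ) := by
        rw [show Real.pi ^ 2 - Real.pi ^ 2 * powSlope q (s ^ 2) =
          Real.pi ^ 2 * (1 - powSlope q (s ^ 2)) by ring, hG, Real.sqrt_mul (by positivity),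
          Real.sqrt_sq hπ.le, Real.sqrt_div hG0.le, Real.sqrt_sq hc.le]
      have hr : 0 < √(s ^ q - s ^ 2) := Real.sqrt_pos.mpr hG0
      have hr2 : √(s ^ q - s ^ 2) < √(s * (1 - s)) := Real.sqrt_lt_sqrt hG0.le (by nlinarith)
      rw [e, ENNReal.ofReal_lt_ofReal_iff (by positivity)]
      calc f θ = Real.cos θ / (Real.pi * √(s * (1 - s))) := by
            simp only [hf]; field_simp; rfl
        _ < Real.cos θ / (Real.pi * √(s ^ q - s ^ 2)) := by gcongr
        _ = _ := by field_simp

theorem continuousOn_integral_slowness (hq0 : 0 ≤ q) (hq2 : q ≤ 2) {k₀ : ℝ}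
    (hk₀ : k₀ < Real.pi ^ 2) :
    ContinuousOn (fun k => ∫ θ in (0 : ℝ)..(Real.pi / 2), slowness q k θ) (Icc 0 k₀) := by
  have hc := continuous_powSlope hq0
  -- Truncation makes the integrand continuous in both variables, without changing it on `[0, k₀]`.
  have h : Continuous fun k => ∫ θ in (0 : ℝ)..(Real.pi / 2),
      1 / √(max (Real.pi ^ 2 - k * powSlope q (Real.sin θ ^ 2)) (Real.pi ^ 2 - k₀)) := by
    refine intervalIntegral.continuous_parametric_intervalIntegral_of_continuous' ?_ _ _
    refine Continuous.div continuous_const (by fun_prop) fun p => ?_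
    exact (Real.sqrt_pos.mpr (lt_max_of_lt_right (by linarith))).ne'
  refine h.continuousOn.congr fun k hk => ?_
  refine intervalIntegral.integral_congr fun θ _ => ?_
  have := (sub_mul_powSlope_mem hq0 hq2 hk.1 (sin_sq_mem_Icc θ)).1
  simp only [slowness]
  rw [max_eq_left (by linarith [hk.2])]

/-- There is a strength for which the positive motion takes exactly the time `1` from height `0`
to its turning point `1`. -/
theorem exists_integral_slowness_eq_one (hq1 : 1 < q) (hq2 : q < 2) :
    ∃ k, 0 < k ∧ k < Real.pi ^ 2 ∧ ∫ θ in (0 : ℝ)..(Real.pi / 2), slowness q k θ = 1 := by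
  have hπ := Real.pi_pos
  have hq0 : 0 ≤ q := by linarith
  have hzero : ∫ θ in (0 : ℝ)..(Real.pi / 2), slowness q 0 θ = 1 / 2 := by
    simp only [slowness, zero_mul, sub_zero, Real.sqrt_sq hπ.le, intervalIntegral.integral_const,
      smul_eq_mul]
    field_simp
  obtain ⟨k₀, hk₀0, hk₀, hT⟩ : ∃ k, 0 ≤ k ∧ k < Real.pi ^ 2 ∧
      1 ≤ ∫ θ in (0 : ℝ)..(Real.pi / 2), slowness q k θ := by
    -- Otherwise Fatou's lemma would bound the time in the limit `k = π²` by `1`.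
    by_contra! hcon
    set κ : ℕ → ℝ := fun n => Real.pi ^ 2 * (1 - 1 / ((n : ℝ) + 1)) with hκ
    have hκ0 : ∀ n, 0 ≤ κ n := fun n => by
      have : 1 / ((n : ℝ) + 1) ≤ 1 := by
        rw [div_le_one (by positivity)]
        linarith [n.cast_nonneg (α := ℝ)]
      exact mul_nonneg (sq_nonneg _) (by linarith)
    have hκ1 : ∀ n, κ n < Real.pi ^ 2 := fun n => by
      have h1 : 0 < 1 / ((n : ℝ) + 1) := by positivity
      have h2 : 0 < Real.pi ^ 2 := by positivity
      simp only [hκ]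
      nlinarith
    have hκlim : Filter.Tendsto κ Filter.atTop (nhds (Real.pi ^ 2)) := by
      have := (tendsto_one_div_add_atTop_nhds_zero_nat (𝕜 := ℝ)).const_sub 1 |>.const_mul
        (Real.pi ^ 2)
      simpa [hκ] using this
    have hfatou := lintegral_liminf_le (μ := volume.restrict (Ioo 0 (Real.pi / 2)))
      (u := Filter.atTop) (f := fun n θ => ENNReal.ofReal (slowness q (κ n) θ))
      (fun n => (continuous_slowness hq0 hq2.le (hκ0 n) (hκ1 n)).measurable.ennreal_ofReal)
    have hle : Filter.liminf (fun n => ∫⁻ θ in Ioo 0 (Real.pi / 2),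
        ENNReal.ofReal (slowness q (κ n) θ)) Filter.atTop ≤ 1 := by
      refine Filter.liminf_le_of_le (by isBoundedDefault) fun b hb => ?_
      obtain ⟨n, hn⟩ := hb.exists
      refine hn.trans ?_
      have hc := continuous_slowness hq0 hq2.le (hκ0 n) (hκ1 n)
      rw [← ofReal_integral_eq_lintegral_ofReal
        (hc.integrableOn_Icc.mono_set Ioo_subset_Icc_self)
        (Filter.Eventually.of_forall fun θ => by simp only [slowness, Pi.zero_apply]; positivity),
        ← integral_Ioc_eq_integral_Ioo, ← intervalIntegral.integral_of_le (by positivity),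
        ENNReal.ofReal_le_one]
      exact (hcon _ (hκ0 n) (hκ1 n)).le
    have heq : ∫⁻ θ in Ioo 0 (Real.pi / 2), Filter.liminf
        (fun n => ENNReal.ofReal (slowness q (κ n) θ)) Filter.atTop =
        ∫⁻ θ in Ioo 0 (Real.pi / 2),
      ENNReal.ofReal (1 / √(Real.pi ^ 2 - Real.pi ^ 2 * powSlope q (Real.sin θ ^ 2))) := by
      refine setLIntegral_congr_fun measurableSet_Ioo fun θ hθ => ?_
      refine Filter.Tendsto.liminf_eq (ENNReal.tendsto_ofReal ?_)
      have hs0 : 0 < Real.sin θ := Real.sin_pos_of_mem_Ioo ⟨hθ.1, by linarith [hθ.2]⟩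
      have hc0 : 0 < Real.cos θ := Real.cos_pos_of_mem_Ioo ⟨by linarith [hθ.1], hθ.2⟩
      have hs1 : Real.sin θ < 1 := by nlinarith [Real.sin_sq_add_cos_sq θ]
      have hsl := one_sub_mul_powSlope q (Real.sin θ ^ 2)
      rw [sq_rpow_half q hs0.le] at hsl
      have hsq2 : Real.sin θ ^ 2 < Real.sin θ ^ q := by
        rw [← Real.rpow_natCast]
        exact Real.rpow_lt_rpow_of_exponent_gt hs0 hs1 (by simpa using hq2)
      have hs2 : 0 < 1 - Real.sin θ ^ 2 := by nlinarith
      have hlt : powSlope q (Real.sin θ ^ 2) < 1 := by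
        by_contra! hge
        linarith [mul_le_mul_of_nonneg_left hge hs2.le]
      have hpos : 0 < Real.pi ^ 2 - Real.pi ^ 2 * powSlope q (Real.sin θ ^ 2) := by
        have : 0 < Real.pi ^ 2 * (1 - powSlope q (Real.sin θ ^ 2)) :=
          mul_pos (by positivity) (by linarith)
        linarith
      exact tendsto_const_nhds.div ((hκlim.mul_const _).const_sub _).sqrt
        (Real.sqrt_pos.mpr hpos).ne'
    rw [heq] at hfatou
    exact absurd (one_lt_lintegral_limit hq1 hq2) (not_lt.mpr (hfatou.trans hle))
  obtain ⟨k, hk, hk1⟩ := intermediate_value_Icc hk₀0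
    (continuousOn_integral_slowness hq0 hq2.le hk₀)
    (show (1 : ℝ) ∈ Icc _ _ from ⟨by rw [hzero]; norm_num, hT⟩)
  refine ⟨k, hk.1.lt_of_ne ?_, hk.2.trans_lt hk₀, hk1⟩
  rintro rfl
  simp only [hzero] at hk1
  norm_num at hk1

/-- For `q = 2` the critical strength is explicit. -/
theorem integral_slowness_two :
    ∫ θ in (0 : ℝ)..(Real.pi / 2), slowness 2 (3 / 4 * Real.pi ^ 2) θ = 1 := by
  have hπ := Real.pi_pos
  have h : ∀ θ, θ ∈ Ioo 0 (Real.pi / 2) → slowness 2 (3 / 4 * Real.pi ^ 2) θ = 2 / Real.pi := by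
    intro θ hθ
    have hc0 : 0 < Real.cos θ := Real.cos_pos_of_mem_Ioo ⟨by linarith [hθ.1], hθ.2⟩
    have hsl := one_sub_mul_powSlope 2 (Real.sin θ ^ 2)
    rw [div_self (two_ne_zero' ℝ), Real.rpow_one] at hsl
    have h1 : powSlope 2 (Real.sin θ ^ 2) = 1 := by
      refine mul_left_cancel₀ (a := 1 - Real.sin θ ^ 2) ?_ (by rw [hsl, mul_one])
      rw [← Real.cos_sq']; positivity
    rw [slowness, h1, show Real.pi ^ 2 - 3 / 4 * Real.pi ^ 2 * 1 = (Real.pi / 2) ^ 2 by ring,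
      Real.sqrt_sq (by positivity)]
    field_simp
  rw [intervalIntegral.integral_of_le (by positivity), integral_Ioc_eq_integral_Ioo,
    setIntegral_congr_fun measurableSet_Ioo h, ← integral_Ioc_eq_integral_Ioo,
    ← intervalIntegral.integral_of_le (by positivity), intervalIntegral.integral_const, smul_eq_mul]
  field_simp
  ring

end

/-- The positive motion from `0` to its turning point `1` and back in the time `2`, obtained by
inverting `θ ↦ ∫ slowness`, where the height is `sin θ`. -/
theorem exists_positive_motion {q k : ℝ} (hq1 : 1 ≤ q) (hq2 : q ≤ 2) (hk0 : 0 ≤ k)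
    (hk : k < Real.pi ^ 2) (hT : ∫ θ in (0 : ℝ)..(Real.pi / 2), slowness q k θ = 1) :
    ∃ y : ℝ → ℝ, ContDiff ℝ 1 y ∧ y (-1) = 0 ∧ y 1 = 0 ∧ y 0 = 1 ∧
      (∀ x ∈ Ioo (-1 : ℝ) 1, 0 < y x) ∧ (∀ x ∈ Ioo (-1 : ℝ) 1, x ≠ 0 → y x < 1) ∧
      (∀ x ∈ Icc (-1 : ℝ) 0, deriv y x = speed q k (Real.pi ^ 2 - k) (y x)) ∧
      ∀ x ∈ Icc (0 : ℝ) 1, deriv y x = -speed q k (Real.pi ^ 2 - k) (y x) := by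
  have hπ := Real.pi_pos
  have hq0 : 0 ≤ q := by linarith
  have hρc := continuous_slowness hq0 hq2 hk0 hk
  have hρπ := inv_pi_le_slowness hq0 hq2 hk0 hk
  set X : ℝ → ℝ := fun t => ∫ θ in (0 : ℝ)..t, slowness q k θ with hX
  have hXd : ∀ t, HasDerivAt X (slowness q k t) t := fun t =>
    intervalIntegral.integral_hasDerivAt_right (hρc.intervalIntegrable _ _)
      hρc.aestronglyMeasurable.stronglyMeasurableAtFilter hρc.continuousAt
  have hρpos : ∀ t, 0 < slowness q k t := fun t => lt_of_lt_of_le (by positivity) (hρπ t)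
  have hXmono : StrictMono X := strictMono_of_hasDerivAt_pos hXd hρpos
  have hXcont : Continuous X := continuous_iff_continuousAt.mpr fun t => (hXd t).continuousAt
  have hmono2 : Monotone fun t => X t - 1 / Real.pi * t :=
    monotone_of_hasDerivAt_nonneg
      (fun t => (hXd t).sub ((hasDerivAt_id t).const_mul (1 / Real.pi)))
      (fun t => by simpa using hρπ t)
  have hX0 : X 0 = 0 := by simp [hX]
  have hsurj : Function.Surjective X := by
    refine hXcont.surjective ?_ ?_
    · refine Filter.tendsto_atTop_mono' _ ?_
        (Filter.tendsto_id.const_mul_atTop (show 0 < 1 / Real.pi by positivity))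
      filter_upwards [Filter.eventually_ge_atTop 0] with t ht
      have := hmono2 ht
      simp only [hX0, mul_zero, sub_zero] at this
      simp only [id]
      linarith
    · refine Filter.tendsto_atBot_mono' _ ?_
        (Filter.tendsto_id.const_mul_atBot (show 0 < 1 / Real.pi by positivity))
      filter_upwards [Filter.eventually_le_atBot 0] with t ht
      have := hmono2 ht
      simp only [hX0, mul_zero, sub_zero] at this
      simp only [id]
      linarith
  set e := hXmono.orderIsoOfSurjective X hsurj with he
  set Θ : ℝ → ℝ := fun x => e.symm x with hΘ
  have hXΘ : ∀ x, X (Θ x) = x := fun x => e.apply_symm_apply x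
  have hΘX : ∀ t, Θ (X t) = t := fun t => e.symm_apply_apply t
  have hΘmono : StrictMono Θ := e.symm.strictMono
  have hΘcont : Continuous Θ := e.symm.continuous
  have hΘd : ∀ x, HasDerivAt Θ (slowness q k (Θ x))⁻¹ x := fun x =>
    HasDerivAt.of_local_left_inverse hΘcont.continuousAt (hXd _) (hρpos _).ne'
      (Filter.Eventually.of_forall hXΘ)
  have hΘ0 : Θ 0 = 0 := by simpa only [hX0] using hΘX 0
  have hΘ1 : Θ 1 = Real.pi / 2 := by rw [← hT]; exact hΘX _
  have hΘ2 : Θ 2 = Real.pi := by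
    have h : X Real.pi = 2 := by
      have h1 : ∫ θ in (Real.pi / 2)..Real.pi, slowness q k θ = 1 := by
        rw [← hT]
        have := intervalIntegral.integral_comp_sub_left (slowness q k) Real.pi
          (a := 0) (b := Real.pi / 2)
        rw [sub_zero, show Real.pi - Real.pi / 2 = Real.pi / 2 by ring] at this
        rw [← this]
        refine intervalIntegral.integral_congr fun θ _ => ?_
        simp only [slowness, Real.sin_pi_sub]
      simp only [hX]
      rw [← intervalIntegral.integral_add_adjacent_intervals (b := Real.pi / 2)
        (hρc.intervalIntegrable _ _) (hρc.intervalIntegrable _ _), hT, h1]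
      norm_num
    rw [← h, hΘX]
  set y : ℝ → ℝ := fun x => Real.sin (Θ (x + 1)) with hy
  have hyd : ∀ x, HasDerivAt y (Real.cos (Θ (x + 1)) * (slowness q k (Θ (x + 1)))⁻¹) x := by
    intro x
    have h1 : HasDerivAt (fun x => Θ (x + 1)) (slowness q k (Θ (x + 1)))⁻¹ x := by
      simpa using (hΘd (x + 1)).comp_add_const x 1
    exact (Real.hasDerivAt_sin _).comp x h1
  have hyderiv : deriv y = fun x => Real.cos (Θ (x + 1)) * (slowness q k (Θ (x + 1)))⁻¹ :=
    funext fun x => (hyd x).deriv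
  have hΘle : ∀ {a b : ℝ}, a ≤ b → Θ a ≤ Θ b := fun h => hΘmono.monotone h
  have hcosabs : ∀ x ∈ Icc (-1 : ℝ) 1,
      |Real.cos (Θ (x + 1))| * (slowness q k (Θ (x + 1)))⁻¹ =
        speed q k (Real.pi ^ 2 - k) (y x) := by
    intro x hx
    have h0 : 0 ≤ Θ (x + 1) := hΘ0 ▸ hΘle (by linarith [hx.1])
    have h1 : Θ (x + 1) ≤ Real.pi := hΘ2 ▸ hΘle (by linarith [hx.2])
    rw [speed_eq_sqrt_mul hq1 k ⟨Real.sin_nonneg_of_nonneg_of_le_pi h0 h1, Real.sin_le_one _⟩,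
      ← Real.cos_sq', Real.sqrt_sq_eq_abs, slowness, one_div, inv_inv]
  refine ⟨y, ?_, ?_, ?_, ?_, ?_, ?_, ?_, ?_⟩
  · rw [contDiff_one_iff_deriv]
    refine ⟨fun x => (hyd x).differentiableAt, ?_⟩
    rw [hyderiv]
    have h1 : Continuous fun x => Θ (x + 1) := hΘcont.comp (by fun_prop)
    exact (Real.continuous_cos.comp h1).mul ((hρc.comp h1).inv₀ fun x => (hρpos _).ne')
  · simp [hy, hΘ0]
  · simp only [hy]
    rw [show (1 : ℝ) + 1 = 2 by norm_num, hΘ2, Real.sin_pi]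
  · simp [hy, hΘ1]
  · intro x hx
    refine Real.sin_pos_of_mem_Ioo ⟨?_, ?_⟩
    · rw [← hΘ0]; exact hΘmono (by linarith [hx.1])
    · rw [← hΘ2]; exact hΘmono (by linarith [hx.2])
  · intro x hx hx0
    have hne : Real.cos (Θ (x + 1)) ≠ 0 := by
      rcases hx0.lt_or_gt with h | h
      · refine (Real.cos_pos_of_mem_Ioo ⟨?_, ?_⟩).ne'
        · have := hΘmono (show (0 : ℝ) < x + 1 by linarith [hx.1])
          rw [hΘ0] at this
          linarith
        · rw [← hΘ1]; exact hΘmono (by linarith)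
      · refine (Real.cos_neg_of_pi_div_two_lt_of_lt ?_ ?_).ne
        · rw [← hΘ1]; exact hΘmono (by linarith)
        · have := hΘmono (show x + 1 < 2 by linarith [hx.2])
          rw [hΘ2] at this
          linarith
    have h1 : 0 < Real.cos (Θ (x + 1)) ^ 2 := by positivity
    have h2 := Real.sin_sq_add_cos_sq (Θ (x + 1))
    simp only [hy]
    nlinarith
  · intro x hx
    rw [← hcosabs x ⟨hx.1, hx.2.trans zero_le_one⟩, hyderiv, abs_of_nonneg]
    refine Real.cos_nonneg_of_mem_Icc ⟨?_, ?_⟩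
    · have := hΘle (show (0 : ℝ) ≤ x + 1 by linarith [hx.1])
      rw [hΘ0] at this
      linarith
    · rw [← hΘ1]; exact hΘle (by linarith [hx.2])
  · intro x hx
    rw [← hcosabs x ⟨by linarith [hx.1], hx.2⟩, hyderiv, abs_of_nonpos]
    · ring
    · refine Real.cos_nonpos_of_pi_div_two_le_of_le ?_ ?_
      · rw [← hΘ1]; exact hΘle (by linarith [hx.1])
      · have := hΘle (show x + 1 ≤ 2 by linarith [hx.2])
        rw [hΘ2] at this
        linarith

theorem memH01_of_contDiff {y : ℝ → ℝ} (hy : ContDiff ℝ 1 y) (hl : y (-1) = 0) (hr : y 1 = 0) :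
    MemH01 y where
  absolutelyContinuous := hy.contDiffOn.absolutelyContinuousOnInterval
  left_eq_zero := hl
  right_eq_zero := hr
  deriv_memLp := by
    have hc : Continuous (deriv y) := hy.continuous_deriv le_rfl
    refine (memLp_two_iff_integrable_sq hc.aestronglyMeasurable.restrict).mpr ?_
    exact (hc.pow 2).integrableOn_Icc.mono_set Ioo_subset_Icc_self

theorem hasDerivAt_speed {q k E s : ℝ} (hq : 1 ≤ q) (hs : 0 < s) (h : potential q k s < E) :
    HasDerivAt (speed q k E)
      ((-Real.pi ^ 2 * s + q / 2 * k * s ^ (q - 1)) / speed q k E s) s := by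
  have hW : HasDerivAt (potential q k) (Real.pi ^ 2 * (2 * s) - k * (q * s ^ (q - 1))) s := by
    have h1 : HasDerivAt (fun s : ℝ => Real.pi ^ 2 * s ^ 2 - k * s ^ q)
        (Real.pi ^ 2 * (2 * s) - k * (q * s ^ (q - 1))) s := by
      have h2 := ((hasDerivAt_pow 2 s).const_mul (Real.pi ^ 2)).sub
        ((Real.hasDerivAt_rpow_const (p := q) (Or.inl hs.ne')).const_mul k)
      exact h2.congr_deriv (by simp)
    refine h1.congr_of_eventuallyEq ?_
    filter_upwards [Ioi_mem_nhds hs] with t ht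
    exact potential_of_nonneg hq k (le_of_lt ht)
  refine ((hW.const_sub E).sqrt (by linarith)).congr_deriv ?_
  rw [speed]
  have : 0 < √(E - potential q k s) := Real.sqrt_pos.mpr (by linarith)
  field_simp
  ring

/-- The positive motion is an extremal function of the sharp inequality. -/
theorem exists_criticalPair_of_integral_slowness {q k : ℝ} (hq1 : 1 ≤ q) (hq2 : q ≤ 2)
    (hk0 : 0 < k) (hk : k < Real.pi ^ 2)
    (hT : ∫ θ in (0 : ℝ)..(Real.pi / 2), slowness q k θ = 1) :
    ∃ J : ℝ, IsCriticalPair q k J ∧ ∃ y ∈ admissible, (∀ x ∈ Ioo (-1 : ℝ) 1, 0 < y x) ∧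
      ∫ x in (-1 : ℝ)..1, signedPow q (y x) = J ∧
      excess (q / 2 * k * J ^ (1 - 2 / q)) q y = 0 := by
  obtain ⟨y, hy, hl, hr, hy0, hpos, hlt, hd1, hd2⟩ := exists_positive_motion hq1 hq2 hk0.le hk hT
  have hu := memH01_of_contDiff hy hl hr
  have hyc := hy.continuous
  have hy'c : Continuous (deriv y) := hy.continuous_deriv le_rfl
  have hzero : (0 : ℝ) ∈ Icc (-1 : ℝ) 1 := by norm_num
  have hrange : ∀ x ∈ Icc (-1 : ℝ) 1, y x ∈ Icc (-0 : ℝ) 1 := by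
    intro x hx
    rw [neg_zero]
    rcases hx.1.eq_or_lt with rfl | h1
    · rw [hl]; norm_num
    rcases hx.2.eq_or_lt with rfl | h2
    · rw [hr]; norm_num
    refine ⟨(hpos x ⟨h1, h2⟩).le, ?_⟩
    by_cases hx0 : x = 0
    · rw [hx0, hy0]
    · exact (hlt x ⟨h1, h2⟩ hx0).le
  have hE : ∀ x ∈ Icc (-1 : ℝ) 1, potential q k (y x) ≤ Real.pi ^ 2 - k := fun x hx =>
    potential_le hq1 hq2 hk0.le hk.le
      (by rw [Real.zero_rpow (by linarith)]; norm_num; exact hk.le) (hrange x hx)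
  set J := ∫ x in (-1 : ℝ)..1, signedPow q (y x) with hJ
  have hsc : Continuous fun x => signedPow q (y x) := (continuous_signedPow hq1).comp hyc
  have hJ0 : 0 < J := by
    refine intervalIntegral.intervalIntegral_pos_of_pos_on (hsc.intervalIntegrable _ _) ?_
      (by norm_num)
    intro x hx
    rw [signedPow_of_nonneg hq1 (hpos x hx).le]
    exact Real.rpow_pos_of_pos (hpos x hx) q
  -- The motion follows its own field, so that the calibration identity has no remainder.
  have hcal := hu.calibration_potential hq1 hE (σ := 1) (by norm_num) hzero
    (show (1 : ℝ) ∈ Icc (-1 : ℝ) 1 by norm_num)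
  have z1 : ∫ x in (-1 : ℝ)..0, (deriv y x - 1 * speed q k (Real.pi ^ 2 - k) (y x)) ^ 2 = 0 := by
    refine (intervalIntegral.integral_congr (g := fun _ => (0 : ℝ)) fun x hx => ?_).trans (by simp)
    rw [uIcc_of_le (by norm_num)] at hx
    simp [hd1 x hx]
  have z2 : ∫ x in (0 : ℝ)..1, (deriv y x - (-1) * speed q k (Real.pi ^ 2 - k) (y x)) ^ 2 = 0 := by
    refine (intervalIntegral.integral_congr (g := fun _ => (0 : ℝ)) fun x hx => ?_).trans (by simp)
    rw [uIcc_of_le (by norm_num)] at hx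
    simp [hd2 x hx]
  rw [z1, z2, intervalIntegral.integral_same, hy0, hr, ← hJ] at hcal
  -- Integration of `(y y')'`.
  have hvir : (∫ x in (-1 : ℝ)..1, deriv y x ^ 2) - Real.pi ^ 2 * (∫ x in (-1 : ℝ)..1, y x ^ 2) +
      q / 2 * k * J = 0 := by
    have hderiv : ∀ x ∈ Ioo (-1 : ℝ) 1 \ {0}, HasDerivAt (fun x => y x * deriv y x)
        (deriv y x ^ 2 - Real.pi ^ 2 * y x ^ 2 + q / 2 * k * signedPow q (y x)) x := by
      rintro x ⟨hx, hx0⟩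
      have hx0 : x ≠ 0 := hx0
      have hyx := hpos x hx
      have hylt := hlt x hx hx0
      have hyd : HasDerivAt y (deriv y x) x := (hy.differentiable one_ne_zero x).hasDerivAt
      have hWlt : potential q k (y x) < Real.pi ^ 2 - k := by
        rw [potential_of_nonneg hq1 k hyx.le]
        have h1 := sq_le_rpow hq2 hyx.le hylt.le
        have h2 : 0 < (Real.pi ^ 2 - k) * (1 - y x ^ 2) := mul_pos (by linarith) (by nlinarith)
        nlinarith [mul_nonneg hk0.le (sub_nonneg.mpr h1)]
      have hspos : 0 < speed q k (Real.pi ^ 2 - k) (y x) := Real.sqrt_pos.mpr (by linarith)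
      have hs := (hasDerivAt_speed hq1 hyx hWlt).comp x hyd
      have hpow : signedPow q (y x) = y x * y x ^ (q - 1) := by
        rw [signedPow, abs_of_pos hyx]; ring
      have hy'' : HasDerivAt (deriv y)
          (-Real.pi ^ 2 * y x + q / 2 * k * y x ^ (q - 1)) x := by
        rcases hx0.lt_or_gt with h | h
        · refine (hs.congr_of_eventuallyEq ?_).congr_deriv ?_
          · filter_upwards [Ioo_mem_nhds hx.1 h] with t ht
            exact hd1 t ⟨ht.1.le, ht.2.le⟩
          · rw [hd1 x ⟨hx.1.le, h.le⟩]
            field_simp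
        · refine (hs.neg.congr_of_eventuallyEq ?_).congr_deriv ?_
          · filter_upwards [Ioo_mem_nhds h hx.2] with t ht
            exact hd2 t ⟨ht.1.le, ht.2.le⟩
          · rw [hd2 x ⟨h.le, hx.2.le⟩]
            field_simp
      refine (hyd.mul hy'').congr_deriv ?_
      rw [hpow]
      ring
    have i1 : IntervalIntegrable (fun x => deriv y x ^ 2) volume (-1) 1 :=
      (hy'c.pow 2).intervalIntegrable _ _
    have i2 : IntervalIntegrable (fun x => Real.pi ^ 2 * y x ^ 2) volume (-1) 1 :=
      ((hyc.pow 2).const_mul _).intervalIntegrable _ _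
    have i3 : IntervalIntegrable (fun x => q / 2 * k * signedPow q (y x)) volume (-1) 1 :=
      (hsc.const_mul _).intervalIntegrable _ _
    have h := integral_eq_of_hasDerivAt_off_countable_of_le (fun x => y x * deriv y x) _
      (by norm_num : (-1 : ℝ) ≤ 1) (countable_singleton 0) (hyc.mul hy'c).continuousOn hderiv
      ((i1.sub i2).add i3)
    rw [intervalIntegral.integral_add (i1.sub i2) i3, intervalIntegral.integral_sub i1 i2,
      intervalIntegral.integral_const_mul, intervalIntegral.integral_const_mul, hl, hr, ← hJ] at h
    linarith
  refine ⟨J, ⟨hk0, hk, hJ0, by linarith⟩, y, ⟨hu, 0, hzero, by rw [hy0]; norm_num⟩, hpos, rfl, ?_⟩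
  rw [excess_eq, ← hJ, abs_of_pos hJ0, mul_assoc (q / 2 * k), ← Real.rpow_add hJ0,
    sub_add_cancel, Real.rpow_one]
  linarith

/-- The sharp inequality for `1 < q ≤ 2`, with its cases of equality and a positive extremal
function; the constant is explicit for `q = 2`. -/
theorem exists_sharp_constant {q : ℝ} (hq1 : 1 < q) (hq2 : q ≤ 2) :
    ∃ α₀ : ℝ, 0 < α₀ ∧
      (∀ u ∈ admissible, 0 ≤ excess α₀ q u ∧ (excess α₀ q u = 0 →
        (∀ x ∈ Ioo (-1 : ℝ) 1, 0 < u x) ∨ (∀ x ∈ Ioo (-1 : ℝ) 1, u x < 0) ∨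
        ∃ C : ℝ, C ≠ 0 ∧ ∀ x ∈ Icc (-1 : ℝ) 1, u x = C * Real.sin (Real.pi * x))) ∧
      (∃ y ∈ admissible, (∀ x ∈ Ioo (-1 : ℝ) 1, 0 < y x) ∧ excess α₀ q y = 0 ∧
        0 < ∫ x in (-1 : ℝ)..1, signedPow q (y x)) ∧
      (q = 2 → α₀ = 3 / 4 * Real.pi ^ 2) := by
  obtain ⟨k, hk0, hk, hT, hk2⟩ : ∃ k, 0 < k ∧ k < Real.pi ^ 2 ∧
      ∫ θ in (0 : ℝ)..(Real.pi / 2), slowness q k θ = 1 ∧ (q = 2 → k = 3 / 4 * Real.pi ^ 2) := by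
    rcases hq2.eq_or_lt with rfl | hlt
    · have : 0 < Real.pi ^ 2 := by positivity
      exact ⟨3 / 4 * Real.pi ^ 2, by positivity, by linarith, integral_slowness_two, fun _ => rfl⟩
    · obtain ⟨k, h0, h1, hT⟩ := exists_integral_slowness_eq_one hq1 hlt
      exact ⟨k, h0, h1, hT, fun h => absurd h hlt.ne⟩
  obtain ⟨J, hJ, y, hy, hpos, hyJ, hy0⟩ :=
    exists_criticalPair_of_integral_slowness hq1.le hq2 hk0 hk hT
  have hJ0 := hJ.J_pos
  refine ⟨q / 2 * k * J ^ (1 - 2 / q), by positivity, fun u hu => hJ.excess_nonneg hq1 hq2 hu,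
    ⟨y, hy, hpos, hy0, hyJ ▸ hJ0⟩, fun h => ?_⟩
  rw [hk2 h, h]
  norm_num

/-! ### The case `q = 1` -/

theorem integral_sqrt_mul_add {m : ℝ} (hm : -1 < m) :
    ∫ s in (-m)..1, √((1 - s) * (s + m)) = Real.pi * (1 + m) ^ 2 / 8 := by
  have h := intervalIntegral.mul_integral_comp_mul_add (a := -1) (b := 1)
    (f := fun s => √((1 - s) * (s + m))) ((1 + m) / 2) ((1 - m) / 2)
  rw [show (1 + m) / 2 * -1 + (1 - m) / 2 = -m by ring,
    show (1 + m) / 2 * 1 + (1 - m) / 2 = 1 by ring] at h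
  have e : ∀ t : ℝ, √((1 - ((1 + m) / 2 * t + (1 - m) / 2)) *
      ((1 + m) / 2 * t + (1 - m) / 2 + m)) = (1 + m) / 2 * √(1 - t ^ 2) := by
    intro t
    rw [show (1 - ((1 + m) / 2 * t + (1 - m) / 2)) * ((1 + m) / 2 * t + (1 - m) / 2 + m) =
      ((1 + m) / 2) ^ 2 * (1 - t ^ 2) by ring, Real.sqrt_mul (sq_nonneg _),
      Real.sqrt_sq (by linarith)]
  simp only [e] at h
  rw [intervalIntegral.integral_const_mul, integral_sqrt_one_sub_sq] at h
  rw [← h]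
  ring

/-- The sharp inequality for `q = 1`, which is Wirtinger's inequality for `u - (∫ u) / 2`. The
potential is harmonic and the calibration gives an explicit lower bound. -/
theorem excess_one_nonneg {u : ℝ → ℝ} (hu : u ∈ admissible) :
    0 ≤ excess (Real.pi ^ 2 / 2) 1 u := by
  obtain ⟨c, hc, m, hm, hr, hmax, hmin⟩ := exists_normalised hu
  have hc2 : 0 < c ^ 2 := by positivity
  refine nonneg_of_mul_nonneg_right ?_ hc2
  rw [← excess_const_mul _ le_rfl]
  have hπ := Real.pi_pos
  have hpot : ∀ s, Real.pi ^ 2 * m - potential 1 (Real.pi ^ 2 * (1 - m)) s =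
      Real.pi ^ 2 * ((1 - s) * (s + m)) := by
    intro s
    rw [potential, signedPow_one]; ring
  have hE : ∀ x ∈ Icc (-1 : ℝ) 1,
      potential 1 (Real.pi ^ 2 * (1 - m)) (c * u x) ≤ Real.pi ^ 2 * m := by
    intro x hx
    have h1 := hr x hx
    have h2 : 0 ≤ Real.pi ^ 2 * ((1 - c * u x) * (c * u x + m)) :=
      mul_nonneg (sq_nonneg _) (mul_nonneg (by linarith [h1.2]) (by linarith [h1.1]))
    linarith [hpot (c * u x)]
  have hlow := (hu.1.const_mul c).lower_bound le_rfl hE hmax hmin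
  have hS : ∫ s in (-m)..1, speed 1 (Real.pi ^ 2 * (1 - m)) (Real.pi ^ 2 * m) s =
      Real.pi * (Real.pi * (1 + m) ^ 2 / 8) := by
    rw [← integral_sqrt_mul_add (by linarith [hm.1]), ← intervalIntegral.integral_const_mul]
    refine intervalIntegral.integral_congr fun s _ => ?_
    simp only [speed]
    rw [hpot, Real.sqrt_mul (sq_nonneg _), Real.sqrt_sq hπ.le]
  rw [hS] at hlow
  -- The multiplier `π² (1 - m)` makes `-m` and `1` the turning points, with energy `π² m`.
  rw [excess_eq_sub (Real.pi ^ 2 / 2) (Real.pi ^ 2 * (1 - m)), div_one, Real.rpow_two, sq_abs]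
  set I := ∫ x in (-1 : ℝ)..1, signedPow 1 (c * u x)
  nlinarith [mul_nonneg (sq_nonneg Real.pi) (sq_nonneg (I - (1 - m)))]

/-! ### Trigonometric functions -/

theorem hasDerivAt_sub_pi_mul (a x : ℝ) : HasDerivAt (fun x => a - Real.pi * x) (-Real.pi) x := by
  simpa using ((hasDerivAt_id x).const_mul Real.pi).const_sub a

theorem integral_sin_phase (a : ℝ) : ∫ x in (-1 : ℝ)..1, Real.sin (a - Real.pi * x) = 0 := by
  have hπ := Real.pi_pos
  have hd : ∀ x ∈ uIcc (-1 : ℝ) 1, HasDerivAt (fun x => Real.cos (a - Real.pi * x) / Real.pi)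
      (Real.sin (a - Real.pi * x)) x := fun x _ => by
    refine (((Real.hasDerivAt_cos _).comp x (hasDerivAt_sub_pi_mul a x)).div_const
      Real.pi).congr_deriv ?_
    field_simp
  rw [intervalIntegral.integral_eq_sub_of_hasDerivAt hd
    (Continuous.intervalIntegrable (by fun_prop) _ _)]
  rw [mul_one, mul_neg, mul_one, sub_neg_eq_add, Real.cos_sub_pi, Real.cos_add_pi, sub_self]

theorem integral_cos_sq_phase (a : ℝ) :
    ∫ x in (-1 : ℝ)..1, Real.cos (a - Real.pi * x) ^ 2 = 1 := by
  have hπ := Real.pi_pos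
  have hd : ∀ x ∈ uIcc (-1 : ℝ) 1, HasDerivAt
      (fun x => x / 2 - Real.sin (a - Real.pi * x) * Real.cos (a - Real.pi * x) / (2 * Real.pi))
      (Real.cos (a - Real.pi * x) ^ 2) x := fun x _ => by
    have h1 := (Real.hasDerivAt_sin _).comp x (hasDerivAt_sub_pi_mul a x)
    have h2 := (Real.hasDerivAt_cos _).comp x (hasDerivAt_sub_pi_mul a x)
    refine (((hasDerivAt_id x).div_const 2).sub
      ((h1.mul h2).div_const (2 * Real.pi))).congr_deriv ?_
    have := Real.sin_sq_add_cos_sq (a - Real.pi * x)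
    simp only [Function.comp]
    field_simp
    linarith
  rw [intervalIntegral.integral_eq_sub_of_hasDerivAt hd
    (Continuous.intervalIntegrable (by fun_prop) _ _)]
  rw [mul_one, mul_neg, mul_one, sub_neg_eq_add, Real.cos_sub_pi, Real.cos_add_pi,
    Real.sin_sub_pi, Real.sin_add_pi]
  ring

theorem integral_sin_sq_phase (a : ℝ) :
    ∫ x in (-1 : ℝ)..1, Real.sin (a - Real.pi * x) ^ 2 = 1 := by
  simp only [Real.sin_sq]
  rw [intervalIntegral.integral_sub intervalIntegrable_const
    (Continuous.intervalIntegrable (by fun_prop) _ _), integral_cos_sq_phase]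
  norm_num

theorem deriv_sin_phase (b a : ℝ) :
    deriv (fun x => b + Real.sin (a - Real.pi * x)) =
      fun x => -Real.pi * Real.cos (a - Real.pi * x) := by
  ext x
  have h : HasDerivAt (fun x => b + Real.sin (a - Real.pi * x))
      (Real.cos (a - Real.pi * x) * -Real.pi) x :=
    ((Real.hasDerivAt_sin _).comp x (hasDerivAt_sub_pi_mul a x)).const_add b
  rw [h.deriv]
  ring

theorem integral_deriv_sin_phase_sq (b a : ℝ) :
    ∫ x in (-1 : ℝ)..1, deriv (fun x => b + Real.sin (a - Real.pi * x)) x ^ 2 = Real.pi ^ 2 := by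
  simp only [deriv_sin_phase, mul_pow, neg_sq]
  rw [intervalIntegral.integral_const_mul, integral_cos_sq_phase, mul_one]

/-- The extremal functions for `q = 1`: the sine waves of period `2`, shifted vertically so as to
vanish at the end points. They factor as `2 cos (π x / 2) sin (π (c - x) / 2)`. -/
def shiftedSine (c x : ℝ) : ℝ :=
  Real.sin (Real.pi * c / 2) + Real.sin (Real.pi * c / 2 - Real.pi * x)

theorem shiftedSine_eq_mul (c x : ℝ) :
    shiftedSine c x = 2 * Real.cos (Real.pi * x / 2) * Real.sin (Real.pi * (c - x) / 2) := by
  rw [shiftedSine, show Real.pi * c / 2 = Real.pi * (c - x) / 2 + Real.pi * x / 2 by ring,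
    show Real.pi * (c - x) / 2 + Real.pi * x / 2 - Real.pi * x =
      Real.pi * (c - x) / 2 - Real.pi * x / 2 by ring, Real.sin_add, Real.sin_sub]
  ring

theorem cos_pi_mul_div_two_pos {x : ℝ} (hx : x ∈ Ioo (-1 : ℝ) 1) :
    0 < Real.cos (Real.pi * x / 2) := by
  have hπ := Real.pi_pos
  exact Real.cos_pos_of_mem_Ioo ⟨by nlinarith [hx.1], by nlinarith [hx.2]⟩

theorem shiftedSine_pos {c x : ℝ} (hx : x ∈ Ioo (-1 : ℝ) 1) (hc : c ≤ 1) (hxc : x < c) :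
    0 < shiftedSine c x := by
  have hπ := Real.pi_pos
  rw [shiftedSine_eq_mul]
  have := cos_pi_mul_div_two_pos hx
  have h2 : 0 < Real.sin (Real.pi * (c - x) / 2) :=
    Real.sin_pos_of_mem_Ioo ⟨by nlinarith, by nlinarith [hx.1]⟩
  positivity

theorem shiftedSine_neg {c x : ℝ} (hx : x ∈ Ioo (-1 : ℝ) 1) (hc : -1 ≤ c) (hxc : c < x) :
    shiftedSine c x < 0 := by
  have hπ := Real.pi_pos
  rw [shiftedSine_eq_mul]
  have := cos_pi_mul_div_two_pos hx
  have h2 : Real.sin (Real.pi * (c - x) / 2) < 0 :=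
    Real.sin_neg_of_neg_of_neg_pi_lt (by nlinarith) (by nlinarith [hx.2])
  exact mul_neg_of_pos_of_neg (by positivity) h2

theorem shiftedSine_mem_admissible {c : ℝ} (hc : c ∈ Ioc (-1 : ℝ) 1) :
    shiftedSine c ∈ admissible := by
  refine ⟨memH01_of_contDiff ?_ ?_ ?_, (c - 1) / 2, ⟨by linarith [hc.1], by linarith [hc.2]⟩,
    (shiftedSine_pos ⟨by linarith [hc.1], by linarith [hc.2]⟩ hc.2 (by linarith [hc.1])).ne'⟩
  · unfold shiftedSine; fun_prop
  · rw [shiftedSine, mul_neg, mul_one, sub_neg_eq_add, Real.sin_add_pi, add_neg_cancel]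
  · rw [shiftedSine, mul_one, Real.sin_sub_pi, add_neg_cancel]

theorem integral_shiftedSine (c : ℝ) :
    ∫ x in (-1 : ℝ)..1, shiftedSine c x = 2 * Real.sin (Real.pi * c / 2) := by
  simp only [shiftedSine]
  rw [intervalIntegral.integral_add intervalIntegrable_const
    (Continuous.intervalIntegrable (by fun_prop) _ _), integral_sin_phase,
    intervalIntegral.integral_const, smul_eq_mul]
  ring

theorem excess_shiftedSine (c : ℝ) : excess (Real.pi ^ 2 / 2) 1 (shiftedSine c) = 0 := by
  have hsq : ∫ x in (-1 : ℝ)..1, shiftedSine c x ^ 2 = 2 * Real.sin (Real.pi * c / 2) ^ 2 + 1 := by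
    simp only [shiftedSine, add_sq]
    rw [intervalIntegral.integral_add (Continuous.intervalIntegrable (by fun_prop) _ _)
      (Continuous.intervalIntegrable (by fun_prop) _ _),
      intervalIntegral.integral_add intervalIntegrable_const
      (Continuous.intervalIntegrable (by fun_prop) _ _), intervalIntegral.integral_const_mul,
      integral_sin_phase, integral_sin_sq_phase, intervalIntegral.integral_const, smul_eq_mul]
    ring
  have hd : ∫ x in (-1 : ℝ)..1, deriv (shiftedSine c) x ^ 2 = Real.pi ^ 2 :=
    integral_deriv_sin_phase_sq _ _
  rw [excess_eq, hsq, hd]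
  simp only [signedPow_one]
  rw [integral_shiftedSine, div_one, Real.rpow_two, sq_abs]
  ring

theorem sin_pi_mul_mem_admissible : (fun x => Real.sin (Real.pi * x)) ∈ admissible := by
  refine ⟨memH01_of_contDiff (by fun_prop) (by simp) (by simp), 1 / 2, by norm_num, ?_⟩
  show Real.sin (Real.pi * (1 / 2)) ≠ 0
  rw [mul_one_div, Real.sin_pi_div_two]
  exact one_ne_zero

theorem excess_sin_pi_mul {q : ℝ} (hq : 1 ≤ q) (α : ℝ) :
    excess α q (fun x => Real.sin (Real.pi * x)) = 0 := by
  have e : (fun x => Real.sin (Real.pi * x)) = fun x => 0 + Real.sin (Real.pi - Real.pi * x) := by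
    ext x; rw [Real.sin_pi_sub, zero_add]
  have hI : ∫ x in (-1 : ℝ)..1, signedPow q (Real.sin (Real.pi * x)) = 0 := by
    have h := intervalIntegral.integral_comp_neg (a := -1) (b := 1)
      (fun x => signedPow q (Real.sin (Real.pi * x)))
    simp only [mul_neg, Real.sin_neg, signedPow_neg, intervalIntegral.integral_neg, neg_neg] at h
    linarith
  have hsq : ∫ x in (-1 : ℝ)..1, Real.sin (Real.pi * x) ^ 2 = 1 := by
    simpa only [Real.sin_pi_sub] using integral_sin_sq_phase Real.pi
  have hd : ∫ x in (-1 : ℝ)..1, deriv (fun x => Real.sin (Real.pi * x)) x ^ 2 = Real.pi ^ 2 := by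
    rw [e]; exact integral_deriv_sin_phase_sq _ _
  rw [excess_eq, hI, hsq, hd, abs_zero, Real.zero_rpow (by positivity)]
  ring

/-! ### The critical value -/

/-- Hölder's inequality, up to the constant. It bounds the quotients from below. -/
theorem abs_integral_signedPow_rpow_le {q : ℝ} (hq1 : 1 ≤ q) (hq2 : q ≤ 2) {u : ℝ → ℝ}
    (hu : u ∈ admissible) :
    |∫ x in (-1 : ℝ)..1, signedPow q (u x)| ^ (2 / q) ≤
      2 ^ (2 / q) * ∫ x in (-1 : ℝ)..1, u x ^ 2 := by
  have hq0 : 0 < q := by linarith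
  have hB := hu.1.integral_sq_pos hu.2
  set B := ∫ x in (-1 : ℝ)..1, u x ^ 2 with hBdef
  set N := B ^ (q / 2) with hN
  have hN0 : 0 < N := Real.rpow_pos_of_pos hB _
  have hl : (-1 : ℝ) ∈ Icc (-1 : ℝ) 1 := by norm_num
  have hr : (1 : ℝ) ∈ Icc (-1 : ℝ) 1 := by norm_num
  have i1 := hu.1.intervalIntegrable_comp (continuous_signedPow hq1).abs hl hr
  have i2 := hu.1.intervalIntegrable_comp (g := fun s => s ^ 2) (continuous_pow 2) hl hr
  have hpt : ∀ x, |signedPow q (u x)| ≤ N * (q / 2 / B * u x ^ 2 + (1 - q / 2)) := by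
    intro x
    have h := le_rpow_two_div hq1 hq2 (t := |u x| ^ q / N) (by positivity)
    have e : (|u x| ^ q / N) ^ (2 / q) = u x ^ 2 / B := by
      rw [Real.div_rpow (by positivity) hN0.le, hN, ← Real.rpow_mul (abs_nonneg _),
        ← Real.rpow_mul hB.le, mul_div_cancel₀ _ hq0.ne',
        show q / 2 * (2 / q) = 1 by field_simp, Real.rpow_one, Real.rpow_two, sq_abs]
    rw [e, div_le_iff₀ hN0] at h
    rw [abs_signedPow hq1]
    refine h.trans_eq ?_
    field_simp
  have h1 : |∫ x in (-1 : ℝ)..1, signedPow q (u x)| ≤ 2 * N := by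
    calc _ ≤ ∫ x in (-1 : ℝ)..1, |signedPow q (u x)| :=
          intervalIntegral.abs_integral_le_integral_abs (by norm_num)
      _ ≤ ∫ x in (-1 : ℝ)..1, N * (q / 2 / B * u x ^ 2 + (1 - q / 2)) :=
          intervalIntegral.integral_mono_on (by norm_num) i1
            (((i2.const_mul _).add intervalIntegrable_const).const_mul _) fun x _ => hpt x
      _ = N * (2 - q / 2) := by
          rw [intervalIntegral.integral_const_mul, intervalIntegral.integral_add (i2.const_mul _)
            intervalIntegrable_const, intervalIntegral.integral_const_mul,
            intervalIntegral.integral_const, ← hBdef, smul_eq_mul]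
          field_simp
          ring
      _ ≤ 2 * N := by nlinarith
  calc _ ≤ (2 * N) ^ (2 / q) := Real.rpow_le_rpow (abs_nonneg _) h1 (by positivity)
    _ = _ := by
        rw [Real.mul_rpow zero_le_two hN0.le, hN, ← Real.rpow_mul hB.le,
          show q / 2 * (2 / q) = 1 by field_simp, Real.rpow_one]

theorem bddBelow_quotient {q : ℝ} (hq1 : 1 ≤ q) (hq2 : q ≤ 2) (α : ℝ) :
    BddBelow (quotient α q '' admissible) := by
  refine ⟨-|α| * 2 ^ (2 / q), ?_⟩
  rintro _ ⟨u, hu, rfl⟩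
  have hB := hu.1.integral_sq_pos hu.2
  have h := abs_integral_signedPow_rpow_le hq1 hq2 hu
  have h1 : 0 ≤ ∫ x in (-1 : ℝ)..1, deriv u x ^ 2 :=
    intervalIntegral.integral_nonneg (by norm_num) fun x _ => sq_nonneg _
  have h2 : 0 ≤ |∫ x in (-1 : ℝ)..1, signedPow q (u x)| ^ (2 / q) := by positivity
  have h3 : -|α| * |∫ x in (-1 : ℝ)..1, signedPow q (u x)| ^ (2 / q) ≤
      α * |∫ x in (-1 : ℝ)..1, signedPow q (u x)| ^ (2 / q) :=
    mul_le_mul_of_nonneg_right (neg_abs_le α) h2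
  have h4 := mul_le_mul_of_nonneg_left h (abs_nonneg α)
  have h5 : quotient α q u = ((∫ x in (-1 : ℝ)..1, deriv u x ^ 2) +
      α * |∫ x in (-1 : ℝ)..1, signedPow q (u x)| ^ (2 / q)) / ∫ x in (-1 : ℝ)..1, u x ^ 2 := by
    simp only [quotient, sq_abs, signedPow]
  rw [h5, le_div_iff₀ hB]
  linarith

theorem pi_sq_le_quotient_iff {u : ℝ → ℝ} (hu : u ∈ admissible) (α q : ℝ) :
    Real.pi ^ 2 ≤ quotient α q u ↔ 0 ≤ excess α q u := by
  rw [← sub_nonneg, quotient_sub hu, le_div_iff₀ (hu.1.integral_sq_pos hu.2), zero_mul]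

theorem quotient_eq_pi_sq_iff {u : ℝ → ℝ} (hu : u ∈ admissible) (α q : ℝ) :
    quotient α q u = Real.pi ^ 2 ↔ excess α q u = 0 := by
  rw [← sub_eq_zero, quotient_sub hu, div_eq_zero_iff]
  exact or_iff_left (hu.1.integral_sq_pos hu.2).ne'

theorem excess_eq_excess_add (α β q : ℝ) (u : ℝ → ℝ) :
    excess β q u = excess α q u +
      (β - α) * |∫ x in (-1 : ℝ)..1, signedPow q (u x)| ^ (2 / q) := by
  rw [excess_eq, excess_eq]; ring

section

variable {q α₀ : ℝ}

theorem eigenvalue_eq_of_le (hq1 : 1 ≤ q) (hnn : ∀ u ∈ admissible, 0 ≤ excess α₀ q u) {α : ℝ}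
    (h : α₀ ≤ α) : eigenvalue α q = Real.pi ^ 2 := by
  refine IsLeast.csInf_eq ⟨⟨_, sin_pi_mul_mem_admissible,
    (quotient_eq_pi_sq_iff sin_pi_mul_mem_admissible _ _).mpr (excess_sin_pi_mul hq1 α)⟩, ?_⟩
  rintro _ ⟨u, hu, rfl⟩
  rw [pi_sq_le_quotient_iff hu, excess_eq_excess_add α₀]
  exact add_nonneg (hnn u hu) (mul_nonneg (by linarith) (by positivity))

theorem eigenvalue_lt_of_lt (hq1 : 1 ≤ q) (hq2 : q ≤ 2) {y : ℝ → ℝ} (hy : y ∈ admissible)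
    (hy0 : excess α₀ q y = 0) (hI : 0 < ∫ x in (-1 : ℝ)..1, signedPow q (y x)) {α : ℝ}
    (h : α < α₀) : eigenvalue α q < Real.pi ^ 2 := by
  refine csInf_lt_of_lt (bddBelow_quotient hq1 hq2 α) ⟨y, hy, rfl⟩ ?_
  rw [← not_le, pi_sq_le_quotient_iff hy, not_le, excess_eq_excess_add α₀, hy0, zero_add,
    abs_of_pos hI]
  exact mul_neg_of_neg_of_pos (by linarith) (Real.rpow_pos_of_pos hI _)

theorem criticalAlpha_eq (hq1 : 1 ≤ q) (hq2 : q ≤ 2)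
    (hnn : ∀ u ∈ admissible, 0 ≤ excess α₀ q u) {y : ℝ → ℝ} (hy : y ∈ admissible)
    (hy0 : excess α₀ q y = 0) (hI : 0 < ∫ x in (-1 : ℝ)..1, signedPow q (y x)) :
    criticalAlpha q = α₀ := by
  have : {α : ℝ | eigenvalue α q = Real.pi ^ 2} = Ici α₀ := by
    ext α
    refine ⟨fun h => ?_, fun h => eigenvalue_eq_of_le hq1 hnn h⟩
    by_contra hlt
    exact (eigenvalue_lt_of_lt hq1 hq2 hy hy0 hI (not_le.mp hlt)).ne h
  rw [criticalAlpha, this, csInf_Ici]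

theorem isMinimizer_iff (hq1 : 1 ≤ q) (hnn : ∀ u ∈ admissible, 0 ≤ excess α₀ q u) {y : ℝ → ℝ} :
    IsMinimizer α₀ q y ↔ y ∈ admissible ∧ excess α₀ q y = 0 := by
  refine and_congr_right fun hy => ⟨fun h => ?_, fun h u hu => ?_⟩
  · have h1 := h sin_pi_mul_mem_admissible
    simp only [mem_ofPred_eq] at h1
    rw [(quotient_eq_pi_sq_iff sin_pi_mul_mem_admissible _ _).mpr (excess_sin_pi_mul hq1 α₀)] at h1
    exact (quotient_eq_pi_sq_iff hy _ _).mp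
      (h1.antisymm ((pi_sq_le_quotient_iff hy _ _).mpr (hnn y hy)))
  · simp only [mem_ofPred_eq]
    rw [(quotient_eq_pi_sq_iff hy _ _).mpr h]
    exact (pi_sq_le_quotient_iff hu _ _).mpr (hnn u hu)

end

theorem integral_shiftedSine_one_pos :
    0 < ∫ x in (-1 : ℝ)..1, signedPow 1 (shiftedSine 1 x) := by
  simp only [signedPow_one]
  rw [integral_shiftedSine, mul_one, Real.sin_pi_div_two]
  norm_num

theorem criticalAlpha_one : criticalAlpha 1 = Real.pi ^ 2 / 2 :=
  criticalAlpha_eq le_rfl one_le_two (fun _ hu => excess_one_nonneg hu)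
    (shiftedSine_mem_admissible ⟨by norm_num, le_rfl⟩) (excess_shiftedSine 1)
    integral_shiftedSine_one_pos

theorem isMinimizer_shiftedSine {c : ℝ} (hc : c ∈ Ioc (-1 : ℝ) 1) :
    IsMinimizer (criticalAlpha 1) 1 (shiftedSine c) := by
  rw [criticalAlpha_one, isMinimizer_iff le_rfl fun _ hu => excess_one_nonneg hu]
  exact ⟨shiftedSine_mem_admissible hc, excess_shiftedSine c⟩

end NonlocalEigenvalue

end

open NonlocalEigenvalue in
theorem theorem1p2 :
    -- the critical value is well defined for every `q` in `[1,2]`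
    (∀ q ∈ Icc (1 : ℝ) 2, 0 < criticalAlpha q ∧
      (∀ α : ℝ, α < criticalAlpha q → eigenvalue α q < Real.pi ^ 2) ∧
      (∀ α : ℝ, criticalAlpha q ≤ α → eigenvalue α q = Real.pi ^ 2)) ∧
    -- the case `q = 1`
    (criticalAlpha 1 = Real.pi ^ 2 / 2 ∧
      (∃ y : ℝ → ℝ, IsMinimizer (criticalAlpha 1) 1 y ∧ ∀ x ∈ Ioo (-1 : ℝ) 1, 0 < y x) ∧
      (∀ x₀ ∈ Ioo (-1 : ℝ) 1, ∃ y : ℝ → ℝ, IsMinimizer (criticalAlpha 1) 1 y ∧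
        y x₀ = 0 ∧ (∀ x ∈ Ioo (-1) x₀, 0 < y x) ∧ (∀ x ∈ Ioo x₀ 1, y x < 0) ∧
        (x₀ ≠ 0 →
          (¬ ∀ x ∈ Icc (-1 : ℝ) 1, y (-x) = y x) ∧
          (¬ ∀ x ∈ Icc (-1 : ℝ) 1, y (-x) = - y x) ∧
          (∫ x in (-1 : ℝ)..1, y x) ≠ 0))) ∧
    -- the case `1 < q ≤ 2`
    (∀ q : ℝ, 1 < q → q ≤ 2 →
      (∃ y : ℝ → ℝ, IsMinimizer (criticalAlpha q) q y ∧ ∀ x ∈ Ioo (-1 : ℝ) 1, 0 < y x) ∧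
      IsMinimizer (criticalAlpha q) q (fun x => Real.sin (Real.pi * x)) ∧
      (∀ y : ℝ → ℝ, IsMinimizer (criticalAlpha q) q y →
        (∀ x ∈ Ioo (-1 : ℝ) 1, 0 < y x) ∨
        (∀ x ∈ Ioo (-1 : ℝ) 1, y x < 0) ∨
        ((∃ C : ℝ, C ≠ 0 ∧ ∀ x ∈ Icc (-1 : ℝ) 1, y x = C * Real.sin (Real.pi * x)) ∧
          ∀ x ∈ Icc (-1 : ℝ) 1, y (-x) = - y x))) ∧
    -- the case `q = 2`
    criticalAlpha 2 = 3 / 4 * Real.pi ^ 2 := by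
  have hπ := Real.pi_pos
  refine ⟨fun q hq => ?_, ⟨criticalAlpha_one, ⟨shiftedSine 1,
    isMinimizer_shiftedSine ⟨by norm_num, le_rfl⟩, fun x hx => shiftedSine_pos hx le_rfl hx.2⟩,
    fun c hc => ?_⟩, fun q hq1 hq2 => ?_, ?_⟩
  · rcases hq.1.eq_or_lt with rfl | hq1
    · rw [criticalAlpha_one]
      exact ⟨by positivity, fun α h => eigenvalue_lt_of_lt le_rfl hq.2
        (shiftedSine_mem_admissible ⟨by norm_num, le_rfl⟩) (excess_shiftedSine 1)
        integral_shiftedSine_one_pos h,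
        fun α h => eigenvalue_eq_of_le le_rfl (fun _ hu => excess_one_nonneg hu) h⟩
    · obtain ⟨α₀, h0, hnn, ⟨y, hy, -, hy0, hI⟩, -⟩ := exists_sharp_constant hq1 hq.2
      rw [criticalAlpha_eq hq.1 hq.2 (fun u hu => (hnn u hu).1) hy hy0 hI]
      exact ⟨h0, fun α h => eigenvalue_lt_of_lt hq.1 hq.2 hy hy0 hI h,
        fun α h => eigenvalue_eq_of_le hq.1 (fun u hu => (hnn u hu).1) h⟩
  · refine ⟨shiftedSine c, isMinimizer_shiftedSine ⟨hc.1, hc.2.le⟩, ?_,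
      fun x hx => shiftedSine_pos ⟨hx.1, hx.2.trans hc.2⟩ hc.2.le hx.2,
      fun x hx => shiftedSine_neg ⟨hc.1.trans hx.1, hx.2⟩ hc.1.le hx.1, fun hc0 => ?_⟩
    · rw [shiftedSine_eq_mul]; simp
    have hs : Real.sin (Real.pi * c / 2) ≠ 0 := by
      rcases hc0.lt_or_gt with h | h
      · exact (Real.sin_neg_of_neg_of_neg_pi_lt (by nlinarith) (by nlinarith [hc.1])).ne
      · exact (Real.sin_pos_of_mem_Ioo ⟨by positivity, by nlinarith [hc.2]⟩).ne'
    refine ⟨fun h => ?_, fun h => ?_, ?_⟩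
    · have hcos := cos_pi_mul_div_two_pos hc
      have h1 := h (1 / 2) (by norm_num)
      simp only [shiftedSine, add_right_inj] at h1
      rw [show Real.pi * c / 2 - Real.pi * -(1 / 2) = Real.pi * c / 2 + Real.pi / 2 by ring,
        show Real.pi * c / 2 - Real.pi * (1 / 2) = Real.pi * c / 2 - Real.pi / 2 by ring,
        Real.sin_add_pi_div_two, Real.sin_sub_pi_div_two] at h1
      linarith
    · have h1 := h 0 (by norm_num)
      simp only [shiftedSine, neg_zero, mul_zero, sub_zero] at h1
      exact hs (by linarith)
    · rw [integral_shiftedSine]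
      exact mul_ne_zero two_ne_zero hs
  · obtain ⟨α₀, h0, hnn, ⟨y, hy, hpos, hy0, hI⟩, -⟩ := exists_sharp_constant hq1 hq2
    have hnn' := fun u hu => (hnn u hu).1
    rw [criticalAlpha_eq hq1.le hq2 hnn' hy hy0 hI]
    simp only [isMinimizer_iff hq1.le hnn']
    refine ⟨⟨y, ⟨hy, hy0⟩, hpos⟩, ⟨sin_pi_mul_mem_admissible, excess_sin_pi_mul hq1.le α₀⟩,
      fun v hv => ?_⟩
    rcases (hnn v hv.1).2 hv.2 with h | h | ⟨C, hC, h⟩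
    · exact Or.inl h
    · exact Or.inr (Or.inl h)
    · refine Or.inr (Or.inr ⟨⟨C, hC, h⟩, fun x hx => ?_⟩)
      rw [h x hx, h (-x) ⟨by linarith [hx.2], by linarith [hx.1]⟩, mul_neg, Real.sin_neg]
      ring
  · obtain ⟨α₀, h0, hnn, ⟨y, hy, -, hy0, hI⟩, h2⟩ :=
      exists_sharp_constant one_lt_two (le_refl (2 : ℝ))
    rw [criticalAlpha_eq one_le_two le_rfl (fun u hu => (hnn u hu).1) hy hy0 hI, h2 rfl]
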